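/- Let $(\mathcal M,V_0,V_1)$ be a compact smooth $n$-dimensional cobordism, $n\ge 1$: a compact Hausdorff smooth manifold with boundary $\partial\mathcal M=V_0\sqcup V_1$, where $V_0,V_1$ are disjoint and closed. Let $h$ be a smooth Riemannian metric on $\mathcal M$, let $\zeta>1$ be a real constant, and let $f:\mathcal M\to[0,1]$ be a smooth Morse function with $f^{-1}(0)=V_0$, $f^{-1}(1)=V_1$, all of whose critical points lie in the interior of $\mathcal M$ and have invertible Hessian. Let $M$ be $\mathcal M$ with the critical points of $f$ removed, with the Morse metric $$g_{\mu\nu}=(h^{\rho\lambda}\partial_\rho f\,\partial_\lambda f)\,h_{\mu\nu}-\zeta\,\partial_\mu f\,\partial_\nu f ,$$ time-oriented by the timelike vector field $\xi^\mu=h^{\mu\nu}\partial_\nu f$; $(M,g)$ is called a Morse geometry. For an open subset $U\subseteq M$ and $x,y\in U$, write $x\ll_U y$ if there is a differentiable curve $\gamma:[0,1]\to U$ from $x$ to $y$ whose tangent vector is everywhere timelike and future-directed (one-sided derivatives at the end points). Put $I^+(x,U)=\{y\in U: x\ll_U y\}$ and $I^-(x,U)=\{y\in U: y\ll_U x\}$,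 and for $S\subseteq U$ let $\downarrow_U S$ and $\uparrow_U S$ be the interiors, in $U$, of $\{q\in U: q\ll_U s\ \forall s\in S\}$ and $\{q\in U: s\ll_U q\ \forall s\in S\}$. The spacetime $(U,g)$ is called causally continuous if $$I^-(x,U)=\,\downarrow_U I^+(x,U)\quad\text{and}\quad I^+(x,U)=\,\uparrow_U I^-(x,U)\qquad\text{for every } x\in U\setminus\partial\mathcal M .$$ Let $a<b$ be real numbers, and let $M_1=\{x\in M: 0\le f(x)<b\}$ and $M_2=\{x\in M: a<f(x)\le 1\}$. Then $M=M_1\cup M_2$, and $(M,g)$ is causally continuous if and only if both $(M_1,g)$ and $(M_2,g)$ are causally continuous. -/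

import Mathlib

open scoped Manifold ContDiff Topology

noncomputable section

namespace MorseGeometry

/-! ### Causal structure -/

section Causal

variable {n : ℕ} [NeZero n] {X : Type*} [TopologicalSpace X]
  [ChartedSpace (EuclideanHalfSpace n) X]

/-- A field of bilinear forms on the tangent spaces of `X`. -/
abbrev MetricField (n : ℕ) [NeZero n] (X : Type*) [TopologicalSpace X]
    [ChartedSpace (EuclideanHalfSpace n) X] : Type _ :=
  ∀ p : X, TangentSpace (𝓡∂ n) p →L[ℝ] TangentSpace (𝓡∂ n) p →L[ℝ] ℝ

/-- A vector field on `X` (no regularity is built in). -/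
abbrev VectorField (n : ℕ) [NeZero n] (X : Type*) [TopologicalSpace X]
    [ChartedSpace (EuclideanHalfSpace n) X] : Type _ :=
  ∀ p : X, TangentSpace (𝓡∂ n) p

/-- A tangent vector `v` at `p` is timelike, signature `(-,+,…,+)`, and lies in the same half of the
light cone as the timelike vector field `T` giving the time orientation. -/
def IsFutureTimelike (g : MetricField n X) (T : VectorField n X) (p : X)
    (v : TangentSpace (𝓡∂ n) p) : Prop :=
  g p v v < 0 ∧ g p (T p) v < 0

/-- `γ` restricted to `[0,1]` is a future-directed timelike curve inside `U`: it is differentiable,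
and its tangent vector is everywhere timelike and future-directed. (At the end points `0` and `1`
the derivative is one-sided; the end points may lie on the boundary of `X`.) -/
structure IsFutureTimelikeCurve (g : MetricField n X) (T : VectorField n X) (U : Set X)
    (γ : ℝ → X) : Prop where
  mapsTo : Set.MapsTo γ (Set.Icc 0 1) U
  mdifferentiableOn : MDifferentiableOn 𝓘(ℝ, ℝ) (𝓡∂ n) γ (Set.Icc 0 1)
  timelike : ∀ t ∈ Set.Icc (0 : ℝ) 1, IsFutureTimelike g T (γ t)
    (mfderivWithin 𝓘(ℝ, ℝ) (𝓡∂ n) γ (Set.Icc 0 1) t (1 : ℝ))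

/-- `x ≪ y` in the spacetime `(U, g|_U)`. -/
def ChronBefore (g : MetricField n X) (T : VectorField n X) (U : Set X) (x y : X) : Prop :=
  ∃ γ : ℝ → X, γ 0 = x ∧ γ 1 = y ∧ IsFutureTimelikeCurve g T U γ

/-- The chronological future `I⁺(x, U)`. -/
def chronFuture (g : MetricField n X) (T : VectorField n X) (U : Set X) (x : X) : Set X :=
  {y | ChronBefore g T U x y}

/-- The chronological past `I⁻(x, U)`. -/
def chronPast (g : MetricField n X) (T : VectorField n X) (U : Set X) (x : X) : Set X :=
  {y | ChronBefore g T U y x}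

/-- The common past `↓S` in the spacetime `(U, g|_U)`: the interior, in the topology of `U`, of
`{q ∈ U : q ≪ s for all s ∈ S}`. -/
def commonPast (g : MetricField n X) (T : VectorField n X) (U : Set X) (S : Set X) : Set X :=
  ((↑) : U → X) '' interior {q : U | ∀ s ∈ S, ChronBefore g T U q s}

/-- The common future `↑S` in the spacetime `(U, g|_U)`: the interior, in the topology of `U`, of
`{q ∈ U : s ≪ q for all s ∈ S}`. -/
def commonFuture (g : MetricField n X) (T : VectorField n X) (U : Set X) (S : Set X) : Set X :=
  ((↑) : U → X) '' interior {q : U | ∀ s ∈ S, ChronBefore g T U s q}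

/-- Causal continuity of the spacetime `(U, g|_U)`, for `U` open in `X` (so that the manifold
boundary of `U` is `U ∩ ∂X`): `I⁻(x) = ↓I⁺(x)` and `I⁺(x) = ↑I⁻(x)` for every `x ∈ U - ∂U`. -/
def CausallyContinuous (g : MetricField n X) (T : VectorField n X) (U : Set X) : Prop :=
  ∀ x ∈ U, x ∉ (𝓡∂ n).boundary X →
    chronPast g T U x = commonPast g T U (chronFuture g T U x) ∧
    chronFuture g T U x = commonFuture g T U (chronPast g T U x)

end Causal

/-! ### Morse functions on cobordisms -/

section Morse

variable {n : ℕ} [NeZero n] {X : Type*} [TopologicalSpace X]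
  [ChartedSpace (EuclideanHalfSpace n) X]

/-- The differential `∂f` at `p`, as a linear form on the tangent space. -/
def differential (f : X → ℝ) (p : X) : TangentSpace (𝓡∂ n) p →L[ℝ] ℝ :=
  mfderiv (𝓡∂ n) 𝓘(ℝ, ℝ) f p

variable (n) in
/-- The set of critical points of `f`. -/
def criticalSet (f : X → ℝ) : Set X := {p | differential (n := n) f p = 0}

variable (n) in
/-- The second derivative `∂_μ ∂_ν f` at `p`, in the preferred chart at `p`. It is used only at
critical points in the interior of `X`, where it is a tensor, so that its nondegeneracy does not
depend on the chart. -/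
def hessian (f : X → ℝ) (p : X) :
    EuclideanSpace ℝ (Fin n) →L[ℝ] EuclideanSpace ℝ (Fin n) →L[ℝ] ℝ :=
  fderiv ℝ (fderiv ℝ (f ∘ (extChartAt (𝓡∂ n) p).symm)) (extChartAt (𝓡∂ n) p p)

/-- `∂X = V₀ ⊔ V₁` (disjoint union of manifolds): for a compact `X` this says that `(X, V₀, V₁)`
is a compact cobordism. -/
structure IsCobordism (n : ℕ) [NeZero n] (X : Type*) [TopologicalSpace X]
    [ChartedSpace (EuclideanHalfSpace n) X] (V₀ V₁ : Set X) : Prop where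
  isClosed_initial : IsClosed V₀
  isClosed_final : IsClosed V₁
  disjoint : Disjoint V₀ V₁
  union_eq : V₀ ∪ V₁ = (𝓡∂ n).boundary X

/-- `f : X → [0,1]` is a Morse function on the cobordism `(X, V₀, V₁)`. -/
structure IsMorseFunction (n : ℕ) [NeZero n] {X : Type*} [TopologicalSpace X]
    [ChartedSpace (EuclideanHalfSpace n) X] (V₀ V₁ : Set X) (f : X → ℝ) : Prop where
  contMDiff : ContMDiff (𝓡∂ n) 𝓘(ℝ, ℝ) ∞ f
  mem_Icc : ∀ p, f p ∈ Set.Icc (0 : ℝ) 1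
  preimage_zero : f ⁻¹' {0} = V₀
  preimage_one : f ⁻¹' {1} = V₁
  critical_interior : criticalSet n f ⊆ (𝓡∂ n).interior X
  nondegenerate : ∀ p ∈ criticalSet n f, ∀ v, (∀ w, hessian n f p v w = 0) → v = 0

end Morse

/-! ### Morse geometries -/

section Geometry

variable {n : ℕ} [NeZero n] {X : Type*} [TopologicalSpace X]
  [ChartedSpace (EuclideanHalfSpace n) X] [IsManifold (𝓡∂ n) ∞ X]

/-- Smooth Riemannian metrics on `X`. -/
abbrev SmoothRiemannianMetric (n : ℕ) [NeZero n] (X : Type*) [TopologicalSpace X]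
    [ChartedSpace (EuclideanHalfSpace n) X] [IsManifold (𝓡∂ n) ∞ X] : Type _ :=
  Bundle.ContMDiffRiemannianMetric (𝓡∂ n) ∞ (EuclideanSpace ℝ (Fin n))
    (fun p : X => TangentSpace (𝓡∂ n) p)

theorem exists_gradient (h : SmoothRiemannianMetric n X) (f : X → ℝ) (p : X) :
    ∃ ξ : TangentSpace (𝓡∂ n) p, ∀ v, h.inner p ξ v = differential f p v := by
  have : FiniteDimensional ℝ (TangentSpace (𝓡∂ n) p) :=
    inferInstanceAs (FiniteDimensional ℝ (EuclideanSpace ℝ (Fin n)))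
  let B : TangentSpace (𝓡∂ n) p →ₗ[ℝ] Module.Dual ℝ (TangentSpace (𝓡∂ n) p) :=
    { toFun := fun v => (h.inner p v : TangentSpace (𝓡∂ n) p →ₗ[ℝ] ℝ)
      map_add' := fun v w => by ext; simp
      map_smul' := fun c v => by ext; simp }
  have hB : Function.Injective B := by
    rw [← LinearMap.ker_eq_bot, LinearMap.ker_eq_bot']
    intro v hv
    by_contra hne
    have h1 : h.inner p v v = 0 := LinearMap.congr_fun hv v
    exact absurd (h.pos p v hne) (by rw [h1]; exact lt_irrefl 0)
  obtain ⟨ξ, hξ⟩ := (LinearMap.injective_iff_surjective_of_finrank_eq_finrank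
    (Subspace.dual_finrank_eq (K := ℝ) (V := TangentSpace (𝓡∂ n) p)).symm).1 hB
    (differential (n := n) f p : TangentSpace (𝓡∂ n) p →ₗ[ℝ] ℝ)
  exact ⟨ξ, fun v => LinearMap.congr_fun hξ v⟩

/-- The gradient `ξ^μ = h^{μν} ∂_ν f`: the vector field with `h(ξ, v) = ∂f(v)` for all `v`. -/
def gradient (h : SmoothRiemannianMetric n X) (f : X → ℝ) : VectorField n X :=
  fun p => (exists_gradient h f p).choose

theorem inner_gradient (h : SmoothRiemannianMetric n X) (f : X → ℝ) (p : X)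
    (v : TangentSpace (𝓡∂ n) p) : h.inner p (gradient h f p) v = differential f p v :=
  (exists_gradient h f p).choose_spec v

/-- The Morse metric `g_{μν} = (h^{ρλ} ∂_ρ f ∂_λ f) h_{μν} - ζ ∂_μ f ∂_ν f`. -/
def morseMetric (h : SmoothRiemannianMetric n X) (f : X → ℝ) (ζ : ℝ) : MetricField n X :=
  fun p => differential f p (gradient h f p) • h.inner p -
    ζ • (differential f p).smulRight (differential f p)

variable (n) in
/-- The manifold `M` of the Morse geometry: `X` with the critical points of `f` removed. -/
def puncturedManifold (f : X → ℝ) : Set X := (criticalSet n f)ᶜ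

end Geometry

end MorseGeometry

end

/-! ### Causal continuity of sublevel and superlevel sets of a time function -/

section AbstractCausality

open Set Filter

variable {X : Type*} [TopologicalSpace X]

/-! The proof separates an order-theoretic argument from the local geometry that feeds it.

Order theory. Since `f` strictly increases along timelike curves, a curve never leaves the slab
between the levels of its end points, so the chronologies of M₁ and M₂ are restrictions of that of
M. The inclusions I⁻(x) ⊆ ↓I⁺(x) and its dual hold by transitivity and openness, so causal
continuity amounts to the reverse inclusions, `PastReflecting` for the relation and for its
reversal. Passing from M to a piece is easy. For the converse and the past inclusion, let q lie in
↓I⁺(x). If f(x) < b, everything takes place in M₁. If f(x) ≥ b and f(q) > a, M₂ suffices. If f(q) ≤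
a, choose a regular level c between a and b and a point p ≫ q below it that is still in the common
past. The closures in the compact X of the slices {y : f(y) = c, p ≪ y ≪ s}, for s ≫ x, form a
directed family, so they share a point y. Reflection at y in M₁ gives q ≪ y; a point z with q ≪ z ≪
y and f(z) > a then satisfies z ≪ x by reflection in M₂. This is `PastReflecting.of_superlevel`.
Future inclusions follow by reversing time and replacing `f` by `-f`.

Geometry. `isChronology_morseCone` supplies transitivity and openness. Timelike curves are only
differentiable and must have a tangent everywhere, so corners cannot be left in a concatenation: a
short piece around the junction is replaced by a nearly straight chart segment whose ends are bent
along parabolas to match prescribed velocities. This uses only that the cones are convex and open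
(`IsConeField`). Nondegenerate critical points are isolated, hence finite in number by compactness,
which yields the regular level c (`exists_regular_level`). -/

theorem mem_image_val_interior_iff {U : Set X} (hU : IsOpen U) {p : X → Prop} {q : X} :
    q ∈ ((↑) : U → X) '' interior {q : U | p q} ↔ q ∈ U ∧ ∀ᶠ q' in 𝓝 q, q' ∈ U ∧ p q' := by
  constructor
  · rintro ⟨⟨q, hq⟩, hqi, rfl⟩
    refine ⟨hq, Filter.Eventually.and (hU.mem_nhds hq) ?_⟩
    rw [mem_interior_iff_mem_nhds] at hqi
    rwa [← map_nhds_subtype_coe_eq_nhds hq (hU.mem_nhds hq), eventually_map]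
  · rintro ⟨hq, hev⟩
    refine ⟨⟨q, hq⟩, ?_, rfl⟩
    rw [mem_interior_iff_mem_nhds]
    rw [← map_nhds_subtype_coe_eq_nhds hq (hU.mem_nhds hq), eventually_map] at hev
    exact hev.mono fun _ h => h.2

/-- A chronology relation on a space `X` with a time function `f`: it is transitive, open, and
related points are joined by continuous chains of related points. -/
structure IsChronology (r : X → X → Prop) (f : X → ℝ) : Prop where
  trans : ∀ {x y z}, r x y → r y z → r x z
  lt : ∀ {x y}, r x y → f x < f y
  isOpen_future : ∀ x, IsOpen {y | r x y}
  isOpen_past : ∀ y, IsOpen {x | r x y}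
  exists_path : ∀ {x y}, r x y → ∃ γ : ℝ → X, ContinuousOn γ (Icc 0 1) ∧ γ 0 = x ∧ γ 1 = y ∧
    ∀ s ∈ Icc (0 : ℝ) 1, ∀ t ∈ Icc (0 : ℝ) 1, s < t → r (γ s) (γ t)
  continuous : Continuous f

namespace IsChronology

variable {r : X → X → Prop} {f : X → ℝ}

theorem swap (h : IsChronology r f) : IsChronology (Function.swap r) (-f) where
  trans h₁ h₂ := h.trans h₂ h₁
  lt h₁ := neg_lt_neg (h.lt h₁)
  isOpen_future := h.isOpen_past
  isOpen_past := h.isOpen_future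
  exists_path {x y} hxy := by
    obtain ⟨γ, hc, h0, h1, hr⟩ := h.exists_path hxy
    refine ⟨fun t => γ (1 - t), hc.comp (by fun_prop) ?_, by simpa, by simpa, ?_⟩
    · rintro t ⟨h0, h1⟩
      constructor <;> linarith
    · rintro s ⟨hs0, hs1⟩ t ⟨ht0, ht1⟩ hst
      exact hr _ ⟨by linarith, by linarith⟩ _ ⟨by linarith, by linarith⟩ (by linarith)
  continuous := h.continuous.neg

theorem exists_between (h : IsChronology r f) {x y : X} (hxy : r x y) {c : ℝ} (hx : f x < c)
    (hy : c < f y) : ∃ z, f z = c ∧ r x z ∧ r z y := by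
  obtain ⟨γ, hc, rfl, rfl, hr⟩ := h.exists_path hxy
  obtain ⟨t, ht, htc⟩ := intermediate_value_Icc (zero_le_one' ℝ)
    (h.continuous.comp_continuousOn hc) ⟨hx.le, hy.le⟩
  have h0 : t ≠ 0 := by rintro rfl; exact hx.ne htc
  have h1 : t ≠ 1 := by rintro rfl; exact hy.ne' htc
  have h0' := lt_of_le_of_ne ht.1 h0.symm
  have h1' := lt_of_le_of_ne ht.2 h1
  exact ⟨γ t, htc, hr _ (by simp) _ ht h0', hr _ ht _ (by simp) h1'⟩

theorem mem_closure_between (h : IsChronology r f) {x y : X} (hxy : r x y) :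
    y ∈ closure {z | r x z ∧ r z y} := by
  obtain ⟨γ, hc, rfl, rfl, hr⟩ := h.exists_path hxy
  have h1 : (1 : ℝ) ∈ closure (Ioo (0 : ℝ) 1) := by
    rw [closure_Ioo zero_ne_one]; simp
  have h2 : ContinuousWithinAt γ (Ioo (0 : ℝ) 1) 1 :=
    (hc 1 (by simp)).mono Ioo_subset_Icc_self
  refine h2.mem_closure h1 fun t ht => ⟨hr _ (by simp) _ ?_ ht.1, hr _ ?_ _ (by simp) ht.2⟩
  exacts [Ioo_subset_Icc_self ht, Ioo_subset_Icc_self ht]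

theorem exists_between_mem (h : IsChronology r f) {x y : X} (hxy : r x y) {W : Set X}
    (hW : W ∈ 𝓝 y) : ∃ z ∈ W, r x z ∧ r z y :=
  mem_closure_iff_nhds.1 (h.mem_closure_between hxy) W hW

theorem exists_between_mem' (h : IsChronology r f) {x y : X} (hxy : r x y) {W : Set X}
    (hW : W ∈ 𝓝 x) : ∃ z ∈ W, r x z ∧ r z y := by
  obtain ⟨z, hz, h₁, h₂⟩ := h.swap.exists_between_mem hxy hW
  exact ⟨z, hz, h₂, h₁⟩

end IsChronology

/-- The nontrivial inclusion `↓I⁺(x) ⊆ I⁻(x)` for a relation `r` on an open set `U`. -/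
def PastReflecting (r : X → X → Prop) (U : Set X) (x : X) : Prop :=
  ∀ q ∈ U, (∀ᶠ q' in 𝓝 q, q' ∈ U ∧ ∀ s, r x s → r q' s) → r q x

/-- One inclusion is free: if q ≪ x, the open set I⁻(x) is a neighbourhood of q that precedes all of
I⁺(x) by transitivity. -/
theorem past_eq_iff {r : X → X → Prop} {U : Set X} (hU : IsOpen U)
    (htrans : ∀ {x y z}, r x y → r y z → r x z) (hmem : ∀ {x y}, r x y → x ∈ U)
    {x : X} (hopen : IsOpen {y | r y x}) :
    {y | r y x} = ((↑) : U → X) '' interior {q : U | ∀ s ∈ {y | r x y}, r q s} ↔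
      PastReflecting r U x := by
  have key : ∀ q, q ∈ ((↑) : U → X) '' interior {q : U | ∀ s ∈ {y | r x y}, r q s} ↔ _ :=
    fun q => mem_image_val_interior_iff (p := fun q => ∀ s ∈ {y | r x y}, r q s) hU
  constructor
  · intro heq q hq hev
    have : q ∈ {y | r y x} := by
      rw [heq, key]
      exact ⟨hq, hev⟩
    exact this
  · intro hP
    ext q
    rw [key]
    constructor
    · intro hq
      exact ⟨hmem hq, Filter.Eventually.mono (hopen.mem_nhds hq)
        fun q' hq' => ⟨hmem hq', fun s hs => htrans hq' hs⟩⟩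
    · rintro ⟨hq, hev⟩
      exact hP q hq hev

/-! ### Passing reflection between M and its sublevel and superlevel sets -/

section Restriction

variable {r : X → X → Prop} {f : X → ℝ} {M : Set X} {a b : ℝ} {x : X}

/-- Points of I⁺(x) above level b impose no further condition on a common past: each of them lies
after a point of I⁺(x) close to x, hence below b. -/
theorem PastReflecting.sublevel (h : IsChronology r f) (hx : f x < b)
    (hP : PastReflecting r M x) :
    PastReflecting (fun x y => r x y ∧ f y < b) (M ∩ {y | f y < b}) x := by
  intro q hq hev
  refine ⟨hP q hq.1 (hev.mono fun q' hq' => ⟨hq'.1.1, fun s hs => ?_⟩), hx⟩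
  obtain ⟨z, hz, h₁, h₂⟩ :=
    h.exists_between_mem' hs ((isOpen_lt h.continuous continuous_const).mem_nhds hx)
  exact h.trans (hq'.2 z ⟨h₁, hz⟩).1 h₂

/-- The future of x is the same in M and in the superlevel set, so the two common-past conditions at
q agree. -/
theorem PastReflecting.superlevel (hP : PastReflecting r M x) (hax : a < f x) :
    PastReflecting (fun x y => r x y ∧ a < f x) (M ∩ {y | a < f y}) x := by
  intro q hq hev
  exact ⟨hP q hq.1 (hev.mono fun q' hq' => ⟨hq'.1.1, fun s hs => (hq'.2 s ⟨hs, hax⟩).1⟩), hq.2⟩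

/-- Because x is a limit of points of I⁺(x), any q' preceding all of I⁺(x) has f(q') ≤ f(x) < b, so
the whole configuration already lies in the sublevel set. -/
theorem PastReflecting.of_sublevel (h : IsChronology r f) (hx : f x < b)
    (hcl : x ∈ closure {z | r x z})
    (hP : PastReflecting (fun x y => r x y ∧ f y < b) (M ∩ {y | f y < b}) x) :
    PastReflecting r M x := by
  intro q hq hev
  have hqx : ∀ q', (∀ s, r x s → r q' s) → f q' < b := fun q' hq' => by
    refine lt_of_le_of_lt ?_ hx
    exact closure_minimal (s := {z | r x z}) (t := {z | f q' ≤ f z})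
      (fun s hs => (h.lt (hq' s hs)).le) (isClosed_le continuous_const h.continuous) hcl
  exact (hP q ⟨hq, hqx q hev.self_of_nhds.2⟩ (hev.mono fun q' hq' =>
    ⟨⟨hq'.1, hqx q' hq'.2⟩, fun s hs => ⟨hq'.2 s hs.1, hs.2⟩⟩)).1

/-- The overlap of the two pieces is used here: a limit point y on the level c is reached from q by
reflection in the sublevel set, and x is reached from a point just before y by reflection in the
superlevel set. -/
theorem PastReflecting.of_superlevel [CompactSpace X] (h : IsChronology r f) (hx : b ≤ f x)
    (hab : a < b) (hcl : x ∈ closure {z | r x z}) {c : ℝ} (hac : a < c) (hcb : c < b)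
    (hmem : ∀ {x y}, r x y → x ∈ M)
    (hP : PastReflecting (fun x y => r x y ∧ a < f x) (M ∩ {y | a < f y}) x)
    (hP₁ : ∀ y, f y = c →
      PastReflecting (fun x y => r x y ∧ f y < b) (M ∩ {y | f y < b}) y) :
    PastReflecting r M x := by
  intro q hq hev
  by_cases haq : a < f q
  · exact (hP q ⟨hq, haq⟩ ((hev.and ((isOpen_lt continuous_const h.continuous).mem_nhds haq)).mono
      fun q' hq' => ⟨⟨hq'.1.1, hq'.2⟩, fun s hs => ⟨hq'.1.2 s hs.1, hq'.2⟩⟩)).1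
  push Not at haq
  obtain ⟨s₀, hs₀⟩ : ({z | r x z}).Nonempty := closure_nonempty_iff.1 ⟨x, hcl⟩
  -- a point `p ≫ q` below the level `c` that is still in the common past
  obtain ⟨p, ⟨hp, hpc⟩, hqp, -⟩ := h.exists_between_mem' (hev.self_of_nhds.2 s₀ hs₀)
    (hev.and ((isOpen_lt h.continuous continuous_const).mem_nhds (haq.trans_lt hac)))
  -- the slices of the level set, directed by the points of `I⁺(x)`
  let K : {z | r x z} → Set X := fun s => closure {y | f y = c ∧ r p y ∧ r y s}
  have hK : (⋂ s, K s).Nonempty := by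
    have : Nonempty {z | r x z} := ⟨⟨s₀, hs₀⟩⟩
    refine IsCompact.nonempty_iInter_of_directed_nonempty_isCompact_isClosed K ?_ ?_
      (fun _ => isClosed_closure.isCompact) (fun _ => isClosed_closure)
    -- Directedness: I⁻(s) ∩ I⁻(t) is a neighbourhood of x, hence contains some z ≫ x, whose slice
    -- lies in both.
    · rintro ⟨s, hs⟩ ⟨t, ht⟩
      obtain ⟨z, ⟨hzs, hzt⟩, hz⟩ := mem_closure_iff_nhds.1 hcl _
        (inter_mem ((h.isOpen_past s).mem_nhds hs) ((h.isOpen_past t).mem_nhds ht))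
      exact ⟨⟨z, hz⟩, closure_mono fun y hy => ⟨hy.1, hy.2.1, h.trans hy.2.2 hzs⟩,
        closure_mono fun y hy => ⟨hy.1, hy.2.1, h.trans hy.2.2 hzt⟩⟩
    · rintro ⟨s, hs⟩
      obtain ⟨y, hy⟩ := h.exists_between (hp.2 s hs) hpc ((hcb.trans_le hx).trans (h.lt hs))
      exact ⟨y, subset_closure hy⟩
  obtain ⟨y, hy⟩ := hK
  rw [mem_iInter] at hy
  have hyc : f y = c := closure_minimal (fun z hz => hz.1)
    (isClosed_eq h.continuous continuous_const) (hy ⟨s₀, hs₀⟩)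
  -- I⁻(p) is a neighbourhood of q, and I⁺(y) ⊆ I⁺(p): if s ≫ y, the open set I⁻(s) meets the slice
  -- at some y' with p ≪ y' ≪ s. So q is in the common past of I⁺(y).
  have hqy : r q y := by
    refine (hP₁ y hyc q ⟨hq, haq.trans_lt hab⟩ ?_).1
    filter_upwards [(h.isOpen_past p).mem_nhds hqp] with q' hq'
    refine ⟨⟨hmem hq', (h.lt hq').trans (hpc.trans hcb)⟩, fun s hs => ⟨?_, hs.2⟩⟩
    obtain ⟨y', hy's, -, hpy', -⟩ := mem_closure_iff_nhds.1 (hy ⟨s₀, hs₀⟩) _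
      ((h.isOpen_past s).mem_nhds hs.1)
    exact h.trans hq' (h.trans hpy' hy's)
  -- a point `z` between `q` and `y`, above the level `a`
  obtain ⟨z, haz, hqz, hzy⟩ := h.exists_between_mem hqy
    ((isOpen_lt continuous_const h.continuous).mem_nhds (hac.trans_eq hyc.symm : a < f y))
  -- Every z' ≪ y precedes all s ≫ x, since I⁺(z') is a neighbourhood of y and so meets the slice
  -- below s.
  refine h.trans hqz (hP z ⟨hmem hzy, haz⟩ ?_).1
  filter_upwards [(h.isOpen_past y).mem_nhds hzy,
    (isOpen_lt continuous_const h.continuous).mem_nhds haz] with z' hz' haz'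
  refine ⟨⟨hmem hz', haz'⟩, fun s hs => ⟨?_, haz'⟩⟩
  obtain ⟨y', hy'z, -, -, hy's⟩ := mem_closure_iff_nhds.1 (hy ⟨s, hs.1⟩) _
    ((h.isOpen_future z').mem_nhds hz')
  exact h.trans hy'z hy's

end Restriction

end AbstractCausality

/-! ### Curves with tangent vectors in a field of open convex cones -/

section ConeCurves

open Set Filter

variable {n : ℕ} [NeZero n] {X : Type*} [TopologicalSpace X]
  [ChartedSpace (EuclideanHalfSpace n) X]

theorem toSpanSingleton_comp_toSpanSingleton {E : Type*} [NormedAddCommGroup E] [NormedSpace ℝ E]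
    (k : ℝ) (v : E) : (ContinuousLinearMap.toSpanSingleton ℝ v).comp
      (ContinuousLinearMap.toSpanSingleton ℝ k) = ContinuousLinearMap.toSpanSingleton ℝ (k • v) := by
  ext
  simp

/-- `γ` is a differentiable curve on `[a,b]` with velocity `V`, tangent to the cones `C`. -/
structure IsConeCurve (C : X → Set (EuclideanSpace ℝ (Fin n))) (γ : ℝ → X)
    (V : ℝ → EuclideanSpace ℝ (Fin n)) (a b : ℝ) : Prop where
  hasMFDerivWithinAt : ∀ t ∈ Icc a b, HasMFDerivWithinAt 𝓘(ℝ, ℝ) (𝓡∂ n) γ (Icc a b) t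
    (ContinuousLinearMap.toSpanSingleton ℝ (V t))
  mem : ∀ t ∈ Icc a b, V t ∈ C (γ t)

/-- There is a curve tangent to the cones `C` from `x` with velocity `u` to `y` with
velocity `w`. -/
def ConeJoins (C : X → Set (EuclideanSpace ℝ (Fin n))) (x : X) (u : EuclideanSpace ℝ (Fin n))
    (y : X) (w : EuclideanSpace ℝ (Fin n)) : Prop :=
  ∃ (a b : ℝ) (γ : ℝ → X) (V : ℝ → EuclideanSpace ℝ (Fin n)), a < b ∧ IsConeCurve C γ V a b ∧
    γ a = x ∧ V a = u ∧ γ b = y ∧ V b = w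

/-- There is a curve tangent to the cones `C` from `x` to `y`. -/
def ConeBefore (C : X → Set (EuclideanSpace ℝ (Fin n))) (x y : X) : Prop :=
  ∃ u w, ConeJoins C x u y w

variable {C C' : X → Set (EuclideanSpace ℝ (Fin n))} {γ γ₁ γ₂ : ℝ → X}
  {V V₁ V₂ : ℝ → EuclideanSpace ℝ (Fin n)} {a b c : ℝ}

theorem IsConeCurve.mono (h : IsConeCurve C γ V a b) {a' b' : ℝ} (ha : a ≤ a') (hb : b' ≤ b) :
    IsConeCurve C γ V a' b' where
  hasMFDerivWithinAt t ht := (h.hasMFDerivWithinAt t ⟨ha.trans ht.1, ht.2.trans hb⟩).mono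
    (Icc_subset_Icc ha hb)
  mem t ht := h.mem t ⟨ha.trans ht.1, ht.2.trans hb⟩

theorem IsConeCurve.continuousOn (h : IsConeCurve C γ V a b) : ContinuousOn γ (Icc a b) :=
  fun t ht => (h.hasMFDerivWithinAt t ht).continuousWithinAt

theorem IsConeCurve.joins (h : IsConeCurve C γ V a b) {s t : ℝ} (hs : a ≤ s) (ht : t ≤ b)
    (hst : s < t) : ConeJoins C (γ s) (V s) (γ t) (V t) :=
  ⟨s, t, γ, V, hst, h.mono hs ht, rfl, rfl, rfl, rfl⟩

/-- Affine reparametrization, possibly reversing the direction. -/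
theorem IsConeCurve.comp_affine (h : IsConeCurve C γ V a b) {k m a' b' : ℝ}
    (hmaps : MapsTo (fun t => k * t + m) (Icc a' b') (Icc a b))
    (hC : ∀ x, ∀ v ∈ C x, k • v ∈ C' x) :
    IsConeCurve C' (fun t => γ (k * t + m)) (fun t => k • V (k * t + m)) a' b' where
  hasMFDerivWithinAt t ht := by
    have h1 : HasDerivWithinAt (fun t : ℝ => k * t + m) k (Icc a' b') t := by
      simpa using (((hasDerivAt_id t).const_mul k).add_const m).hasDerivWithinAt
    have h2 := (h.hasMFDerivWithinAt _ (hmaps ht)).comp t h1.hasFDerivWithinAt.hasMFDerivWithinAt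
      hmaps.subset_preimage
    refine h2.congr_mfderiv ?_
    exact toSpanSingleton_comp_toSpanSingleton k (V (k * t + m))
  mem t ht := hC _ _ (h.mem _ (hmaps ht))

/-- Equality of the velocities at b makes the two one-sided derivatives agree there; this is why
`ConeJoins` records end velocities. -/
theorem IsConeCurve.glue (h₁ : IsConeCurve C γ₁ V₁ a b) (h₂ : IsConeCurve C γ₂ V₂ b c)
    (hab : a < b) (hbc : b < c) (hγ : γ₁ b = γ₂ b) (hV : V₁ b = V₂ b) :
    IsConeCurve C (fun t => if t ≤ b then γ₁ t else γ₂ t)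
      (fun t => if t ≤ b then V₁ t else V₂ t) a c := by
  have e₂ : ∀ t ∈ Icc b c, (fun t => if t ≤ b then γ₁ t else γ₂ t) t = γ₂ t := by
    intro t ht
    rcases ht.1.eq_or_lt with rfl | hlt
    · simpa using hγ
    · simp [not_le.2 hlt]
  have e₁ : ∀ t ∈ Icc a b, (fun t => if t ≤ b then γ₁ t else γ₂ t) t = γ₁ t := by
    intro t ht
    simp [ht.2]
  have d₁ : ∀ t ∈ Icc a b, HasMFDerivWithinAt 𝓘(ℝ, ℝ) (𝓡∂ n)
      (fun t => if t ≤ b then γ₁ t else γ₂ t) (Icc a b) t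
      (ContinuousLinearMap.toSpanSingleton ℝ (V₁ t)) := fun t ht =>
    (h₁.hasMFDerivWithinAt t ht).congr_mono e₁ (e₁ t ht) subset_rfl
  have d₂ : ∀ t ∈ Icc b c, HasMFDerivWithinAt 𝓘(ℝ, ℝ) (𝓡∂ n)
      (fun t => if t ≤ b then γ₁ t else γ₂ t) (Icc b c) t
      (ContinuousLinearMap.toSpanSingleton ℝ (V₂ t)) := fun t ht =>
    (h₂.hasMFDerivWithinAt t ht).congr_mono e₂ (e₂ t ht) subset_rfl
  constructor
  · intro t ht
    rcases lt_trichotomy t b with hlt | rfl | hgt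
    · refine ((d₁ t ⟨ht.1, hlt.le⟩).mono_of_mem_nhdsWithin ?_).congr_mfderiv ?_
      · filter_upwards [self_mem_nhdsWithin, mem_nhdsWithin_of_mem_nhds (Iio_mem_nhds hlt)]
          with s hs hs'
        exact ⟨hs.1, le_of_lt hs'⟩
      · simp only [if_pos hlt.le]
        rfl
    · rw [← Icc_union_Icc_eq_Icc hab.le hbc.le]
      refine HasMFDerivWithinAt.union ((d₁ t (right_mem_Icc.2 hab.le)).congr_mfderiv ?_)
        ((d₂ t (left_mem_Icc.2 hbc.le)).congr_mfderiv ?_)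
      · simp only [if_pos le_rfl]
        rfl
      · simp only [if_pos le_rfl, hV]
        rfl
    · refine ((d₂ t ⟨hgt.le, ht.2⟩).mono_of_mem_nhdsWithin ?_).congr_mfderiv ?_
      · filter_upwards [self_mem_nhdsWithin, mem_nhdsWithin_of_mem_nhds (Ioi_mem_nhds hgt)]
          with s hs hs'
        exact ⟨le_of_lt hs', hs.2⟩
      · simp only [if_neg (not_le.2 hgt)]
        rfl
  · intro t ht
    by_cases htb : t ≤ b
    · simpa [htb] using h₁.mem t ⟨ht.1, htb⟩
    · simpa [htb] using h₂.mem t ⟨(not_le.1 htb).le, ht.2⟩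

theorem ConeJoins.trans {x y z : X} {u v w : EuclideanSpace ℝ (Fin n)}
    (h₁ : ConeJoins C x u y v) (h₂ : ConeJoins C y v z w) : ConeJoins C x u z w := by
  obtain ⟨a, b, γ₁, V₁, hab, hγ₁, rfl, rfl, rfl, rfl⟩ := h₁
  obtain ⟨c, d, γ₂, V₂, hcd, hγ₂, hx, hu, rfl, rfl⟩ := h₂
  have h₃ := hγ₂.comp_affine (C' := C) (k := 1) (m := c - b) (a' := b) (b' := b + (d - c))
    (fun t ht => ⟨by linarith [ht.1], by linarith [ht.2]⟩) (by simp)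
  have h₄ := hγ₁.glue h₃ hab (by linarith) (by simp [hx]) (by simp [hu])
  refine ⟨a, b + (d - c), _, _, by linarith, h₄, by simp [hab.le], by simp [hab.le],
    ?_, ?_⟩
  · rw [if_neg (by linarith)]
    congr 1
    ring
  · rw [if_neg (by linarith), one_smul]
    congr 1
    ring

theorem ConeBefore.neg {x y : X} (h : ConeBefore C x y) : ConeBefore (fun p => -C p) y x := by
  obtain ⟨u, w, a, b, γ, V, hab, hγ, rfl, rfl, rfl, rfl⟩ := h
  have h₃ := hγ.comp_affine (C' := fun p => -C p) (k := -1) (m := 0) (a' := -b) (b' := -a)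
    (fun t ht => ⟨by linarith [ht.2], by linarith [ht.1]⟩) (by simp)
  exact ⟨_, _, -b, -a, _, _, by linarith, h₃, by simp, rfl, by simp, rfl⟩

theorem ConeBefore.exists_unit (hC : ∀ x, ∀ v ∈ C x, ∀ k > (0 : ℝ), k • v ∈ C x) {x y : X}
    (h : ConeBefore C x y) : ∃ γ V, IsConeCurve C γ V 0 1 ∧ γ 0 = x ∧ γ 1 = y := by
  obtain ⟨u, w, a, b, γ, V, hab, hγ, rfl, rfl, rfl, rfl⟩ := h
  refine ⟨_, _, hγ.comp_affine (C' := C) (k := b - a) (m := a) (a' := 0) (b' := 1)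
    (fun t ht => ⟨?_, ?_⟩) fun x v hv => hC x v hv _ (sub_pos.2 hab), by simp, by simp⟩
  · have := mul_nonneg (sub_pos.2 hab).le ht.1
    linarith
  · have := mul_le_mul_of_nonneg_left ht.2 (sub_pos.2 hab).le
    linarith

end ConeCurves

/-! ### Cone fields in charts -/

section ChartCone

open Set Filter

variable {n : ℕ} [NeZero n] {X : Type*} [TopologicalSpace X]
  [ChartedSpace (EuclideanHalfSpace n) X]

/-- The inverse of the preferred chart at `y`, differentiated at the point `z`. -/
noncomputable def chartSymmDeriv (y : X) (z : EuclideanSpace ℝ (Fin n)) :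
    EuclideanSpace ℝ (Fin n) →L[ℝ] EuclideanSpace ℝ (Fin n) :=
  mfderivWithin 𝓘(ℝ, EuclideanSpace ℝ (Fin n)) (𝓡∂ n) (extChartAt (𝓡∂ n) y).symm
    (range (𝓡∂ n)) z

/-- The field of cones `C` in the preferred chart at `y`. -/
def chartCone (C : X → Set (EuclideanSpace ℝ (Fin n))) (y : X) :
    Set (EuclideanSpace ℝ (Fin n) × EuclideanSpace ℝ (Fin n)) :=
  {p | p.1 ∈ (extChartAt (𝓡∂ n) y).target ∧
    chartSymmDeriv y p.1 p.2 ∈ C ((extChartAt (𝓡∂ n) y).symm p.1)}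

/-- A field of open convex cones such that curves tangent to the cones meet the boundary only at
their end points. -/
structure IsConeField (C : X → Set (EuclideanSpace ℝ (Fin n))) : Prop where
  convex : ∀ x, Convex ℝ (C x)
  smul_mem : ∀ x, ∀ v ∈ C x, ∀ k > (0 : ℝ), k • v ∈ C x
  exists_isOpen : ∀ y, ∃ O, IsOpen O ∧ chartCone C y = O ∩ (range (𝓡∂ n) ×ˢ univ)
  interior : ∀ {x y z}, ConeBefore C x y → ConeBefore C y z → y ∈ (𝓡∂ n).interior X

variable {C : X → Set (EuclideanSpace ℝ (Fin n))} {a b : ℝ}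

theorem ConeBefore.of_neg {x y : X} (h : ConeBefore (fun p => -C p) x y) : ConeBefore C y x := by
  simpa using h.neg

theorem IsConeField.neg (h : IsConeField C) : IsConeField (fun p => -C p) where
  convex x := (h.convex x).neg
  smul_mem x v hv k hk := by
    have := h.smul_mem x _ hv k hk
    rwa [smul_neg] at this
  exists_isOpen y := by
    obtain ⟨O, hO, hCO⟩ := h.exists_isOpen y
    refine ⟨(fun p => (p.1, -p.2)) ⁻¹' O, hO.preimage (by fun_prop), ?_⟩
    ext ⟨z, v⟩
    have := Set.ext_iff.1 hCO (z, -v)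
    simpa [chartCone] using this
  interior h₁ h₂ := h.interior h₂.of_neg h₁.of_neg

theorem smul_mem_chartCone (h : IsConeField C) {y : X} {z v : EuclideanSpace ℝ (Fin n)}
    (hz : (z, v) ∈ chartCone C y) {k : ℝ} (hk : 0 < k) : (z, k • v) ∈ chartCone C y := by
  refine ⟨hz.1, ?_⟩
  have := h.smul_mem _ _ hz.2 k hk
  rwa [← map_smul] at this

theorem chartCone_convex (h : IsConeField C) {y : X} {z u v : EuclideanSpace ℝ (Fin n)}
    (hu : (z, u) ∈ chartCone C y) (hv : (z, v) ∈ chartCone C y) {s : ℝ} (hs : s ∈ Icc (0 : ℝ) 1) :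
    (z, u + s • (v - u)) ∈ chartCone C y := by
  refine ⟨hu.1, ?_⟩
  have := (h.convex _).add_smul_sub_mem hu.2 hv.2 hs
  rwa [← map_sub, ← map_smul, ← map_add] at this

theorem chartCone_add (h : IsConeField C) {y : X} {z u v : EuclideanSpace ℝ (Fin n)}
    (hu : (z, u) ∈ chartCone C y) (hv : (z, v) ∈ chartCone C y) :
    (z, u + v) ∈ chartCone C y := by
  have h1 := smul_mem_chartCone h (chartCone_convex h hu hv (s := 1 / 2) (by norm_num))
    (zero_lt_two (α := ℝ))
  convert h1 using 2
  module

variable [IsManifold (𝓡∂ n) 1 X]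

theorem chartSymmDeriv_self (y : X) :
    chartSymmDeriv y (extChartAt (𝓡∂ n) y y) = ContinuousLinearMap.id ℝ _ :=
  mfderivWithin_range_extChartAt_symm (I := 𝓡∂ n) (x := y)

theorem mem_chartCone_self {y : X} {v : EuclideanSpace ℝ (Fin n)} (hv : v ∈ C y) :
    (extChartAt (𝓡∂ n) y y, v) ∈ chartCone C y := by
  refine ⟨mem_extChartAt_target y, ?_⟩
  rw [chartSymmDeriv_self, extChartAt_to_inv]
  exact hv

theorem exists_mem_chartCone {y p : X} (hp : p ∈ (extChartAt (𝓡∂ n) y).source)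
    {v : EuclideanSpace ℝ (Fin n)} (hv : v ∈ C p) :
    ∃ u, (extChartAt (𝓡∂ n) y p, u) ∈ chartCone C y ∧
      chartSymmDeriv y (extChartAt (𝓡∂ n) y p) u = v := by
  have h1 : chartSymmDeriv y (extChartAt (𝓡∂ n) y p)
      (mfderiv (𝓡∂ n) 𝓘(ℝ, EuclideanSpace ℝ (Fin n)) (extChartAt (𝓡∂ n) y) p v) = v :=
    DFunLike.congr_fun
      (mfderivWithin_extChartAt_symm_comp_mfderiv_extChartAt' (I := 𝓡∂ n) (x := y) hp) v
  refine ⟨_, ⟨(extChartAt (𝓡∂ n) y).map_source hp, ?_⟩, h1⟩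
  rw [(extChartAt (𝓡∂ n) y).left_inv hp]
  rwa [h1]

theorem IsConeCurve.of_chart {y : X} {P V : ℝ → EuclideanSpace ℝ (Fin n)}
    (hP : ∀ t ∈ Icc a b, HasDerivWithinAt P (V t) (Icc a b) t)
    (hmem : ∀ t ∈ Icc a b, (P t, V t) ∈ chartCone C y) :
    IsConeCurve C (fun t => (extChartAt (𝓡∂ n) y).symm (P t))
      (fun t => chartSymmDeriv y (P t) (V t)) a b where
  hasMFDerivWithinAt t ht := by
    have h1 := (mdifferentiableWithinAt_extChartAt_symm (hmem t ht).1).hasMFDerivWithinAt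
    have h2 := h1.comp t (hP t ht).hasFDerivWithinAt.hasMFDerivWithinAt fun s hs =>
      extChartAt_target_subset_range y (hmem s hs).1
    refine h2.congr_mfderiv ?_
    refine ContinuousLinearMap.ext_ring ?_
    change chartSymmDeriv y (P t) ((1 : ℝ) • V t) = (1 : ℝ) • chartSymmDeriv y (P t) (V t)
    rw [one_smul, one_smul]
  mem t ht := (hmem t ht).2

/-- Position and velocity at time `η * s` on the parabola which starts at `A` with velocity `u`
and has velocity `v` at time `η`. -/
noncomputable def parabola {E : Type*} [AddCommGroup E] [Module ℝ E] (η : ℝ) (A u v : E) (s : ℝ) : E × E :=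
  (A + (η * s) • u + (η * s ^ 2 / 2) • (v - u), u + s • (v - u))

/-- Compactness of [0,1] makes membership stable in the parameters. With time rescaled to s, the
value η = 0 is allowed: the position is then frozen at A while the velocity runs from u to v. -/
theorem eventually_parabola_mem {E : Type*} [NormedAddCommGroup E] [NormedSpace ℝ E]
    {O : Set (E × E)} (hO : IsOpen O) {η : ℝ} {A u v : E}
    (h : ∀ s ∈ Icc (0 : ℝ) 1, parabola η A u v s ∈ O) :
    ∀ᶠ p : ℝ × E × E × E in 𝓝 (η, A, u, v),
      ∀ s ∈ Icc (0 : ℝ) 1, parabola p.1 p.2.1 p.2.2.1 p.2.2.2 s ∈ O := by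
  refine isCompact_Icc.eventually_forall_of_forall_eventually fun s hs => ?_
  have hc : Continuous fun q : (ℝ × E × E × E) × ℝ =>
      parabola q.1.1 q.1.2.1 q.1.2.2.1 q.1.2.2.2 q.2 := by
    unfold parabola
    fun_prop
  exact (hO.preimage hc).mem_nhds (h s hs)

/-- The elementary piece for changing velocity; for u = v it is a straight segment. -/
theorem ConeJoins.parabola {y : X} {η : ℝ} (hη : 0 < η) {A u v : EuclideanSpace ℝ (Fin n)}
    (h : ∀ s ∈ Icc (0 : ℝ) 1, parabola η A u v s ∈ chartCone C y) :
    ConeJoins C ((extChartAt (𝓡∂ n) y).symm A) (chartSymmDeriv y A u)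
      ((extChartAt (𝓡∂ n) y).symm (A + (η / 2) • (u + v)))
      (chartSymmDeriv y (A + (η / 2) • (u + v)) v) := by
  have h1 := IsConeCurve.of_chart (C := C) (y := y) (a := 0) (b := η)
    (P := fun t => A + t • u + (t ^ 2 / (2 * η)) • (v - u)) (V := fun t => u + (t / η) • (v - u))
    (fun t ht => ?_) (fun t ht => ?_)
  · refine ⟨0, η, _, _, hη, h1, by simp, by simp, ?_, ?_⟩
    · congr 1
      rw [show η ^ 2 / (2 * η) = η / 2 by field_simp]
      module
    · rw [show η ^ 2 / (2 * η) = η / 2 by field_simp, div_self hη.ne']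
      congr 2
      · module
      · module
  · have h2 : HasDerivAt (fun t : ℝ => t ^ 2 / (2 * η)) (t / η) t := by
      refine ((hasDerivAt_pow 2 t).div_const (2 * η)).congr_deriv ?_
      field_simp
      simp
    have h3 := (((hasDerivAt_id t).smul_const u).const_add A).add (h2.smul_const (v - u))
    exact (h3.congr_deriv (by simp)).hasDerivWithinAt
  · convert h (t / η) ⟨div_nonneg ht.1 hη.le, div_le_one_of_le₀ ht.2 hη.le⟩ using 1
    unfold _root_.parabola
    rw [show η * (t / η) = t by field_simp,
      show η * (t / η) ^ 2 / 2 = t ^ 2 / (2 * η) by field_simp]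

end ChartCone

/-! ### Bending segments to match prescribed end velocities -/

section Bridge

open Set Filter

variable {n : ℕ} [NeZero n] {X : Type*} [TopologicalSpace X]
  [ChartedSpace (EuclideanHalfSpace n) X]
  {C : X → Set (EuclideanSpace ℝ (Fin n))} {a b : ℝ}

/-- Over interior points of the half-space the cones form a truly open set, so perturbed curves need
no separate check that they stay in the half-space. -/
theorem exists_isOpen_interior_chartCone (h : IsConeField C) (y : X) :
    ∃ O, IsOpen O ∧ O ⊆ chartCone C y ∧ ∀ p ∈ chartCone C y,
      p.1 ∈ interior (range (𝓡∂ n)) → p ∈ O := by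
  obtain ⟨O, hO, hCO⟩ := h.exists_isOpen y
  refine ⟨O ∩ (interior (range (𝓡∂ n)) ×ˢ univ), hO.inter (isOpen_interior.prod isOpen_univ),
    ?_, ?_⟩
  · rw [hCO]
    exact inter_subset_inter_right _ (prod_mono interior_subset subset_rfl)
  · intro p hp hpi
    rw [hCO] at hp
    exact ⟨hp.1, hpi, trivial⟩

variable [IsManifold (𝓡∂ n) 1 X]

/-- A curve from an interior point `A` with prescribed initial velocity to any point `B`, close to
a straight segment. -/
theorem exists_coneJoins_of_segment (h : IsConeField C) {y : X} {A B u : EuclideanSpace ℝ (Fin n)}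
    (hA : A ∈ interior (range (𝓡∂ n))) (hB : B ∈ range (𝓡∂ n)) (hu : (A, u) ∈ chartCone C y)
    (hd : ∀ s ∈ Icc (0 : ℝ) 1, (A + s • (B - A), B - A) ∈ chartCone C y) :
    ∃ v, ConeJoins C ((extChartAt (𝓡∂ n) y).symm A) (chartSymmDeriv y A u)
      ((extChartAt (𝓡∂ n) y).symm B) v := by
  obtain ⟨O, hO, hCO⟩ := h.exists_isOpen y
  obtain ⟨O', hO', hO'C, hCO'⟩ := exists_isOpen_interior_chartCone h y
  -- In the limit η = 0 the velocities sweep the segment from u to B - A, which lies in the cone at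
  -- A by convexity.
  have e₁ := eventually_parabola_mem hO' (η := 0) (A := A) (u := u) (v := B - A) fun s hs => by
    have hd0 := hd 0 (by simp)
    rw [zero_smul, add_zero] at hd0
    simpa [parabola] using hCO' _ (chartCone_convex h hu hd0 hs) hA
  have e₂ := eventually_parabola_mem hO (η := 1) (A := A) (u := B - A) (v := B - A) fun s hs => by
    have := hd s hs
    rw [hCO] at this
    simpa [parabola] using this.1
  -- Chosen so that turning from u to `v η` in time η and then moving at `v η` for time 1 - η ends
  -- exactly at B.
  let v : ℝ → EuclideanSpace ℝ (Fin n) := fun η => (1 - η / 2)⁻¹ • (B - A - (η / 2) • u)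
  have hv : ContinuousAt v 0 := by
    unfold v
    fun_prop (disch := norm_num)
  have hv0 : v 0 = B - A := by simp [v]
  have t₁ : Tendsto (fun η : ℝ => (η, A, u, v η)) (𝓝[>] 0) (𝓝 (0, A, u, B - A)) := by
    have : ContinuousAt (fun η : ℝ => (η, A, u, v η)) 0 := by fun_prop
    simpa [ContinuousAt, hv0] using this.mono_left nhdsWithin_le_nhds
  have t₂ : Tendsto (fun η : ℝ => (1 - η, A + (η / 2) • (u + v η), v η, v η)) (𝓝[>] 0)
      (𝓝 (1, A, B - A, B - A)) := by
    have : ContinuousAt (fun η : ℝ => (1 - η, A + (η / 2) • (u + v η), v η, v η)) 0 := by fun_prop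
    simpa [ContinuousAt, hv0] using this.mono_left nhdsWithin_le_nhds
  obtain ⟨η, ⟨⟨h₁, h₂⟩, hη⟩, hη1⟩ := (((t₁.eventually e₁).and (t₂.eventually e₂)).and
    self_mem_nhdsWithin |>.and (mem_nhdsWithin_of_mem_nhds (Iio_mem_nhds one_pos))).exists
  have hη : 0 < η := hη
  have hη1 : η < 1 := hη1
  have hve : (1 - η / 2) • v η = B - A - (η / 2) • u := by
    unfold v
    rw [smul_smul, mul_inv_cancel₀ (by linarith), one_smul]
  have hend : A + (η / 2) • (u + v η) + ((1 - η) / 2) • (v η + v η) = B := by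
    have : A + (η / 2) • (u + v η) + ((1 - η) / 2) • (v η + v η) =
      A + (η / 2) • u + (1 - η / 2) • v η := by module
    rw [this, hve]
    module
  have j₁ := ConeJoins.parabola hη fun s hs => hO'C (h₁ s hs)
  have hA' : A + (η / 2) • (u + v η) ∈ range (𝓡∂ n) := by
    have := extChartAt_target_subset_range (I := 𝓡∂ n) y (hO'C (h₁ 1 (by simp))).1
    simp only [parabola] at this
    convert this using 1
    module
  -- B may be a boundary point, so the cone is only relatively open here; convexity of the
  -- half-space keeps the straight piece inside.
  have j₂ := ConeJoins.parabola (C := C) (y := y) (A := A + (η / 2) • (u + v η)) (u := v η)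
    (v := v η) (sub_pos.2 hη1) fun s hs => by
      rw [hCO]
      refine ⟨h₂ s hs, ?_, trivial⟩
      convert (𝓡∂ n).convex_range.add_smul_sub_mem hA' hB hs using 1
      rw [← hend]
      simp only [parabola]
      module
  rw [hend] at j₂
  exact ⟨_, j₁.trans j₂⟩

/-- A curve between interior points `A` and `B` with prescribed velocities at the end points, close
to a straight segment. -/
theorem coneJoins_of_segment (h : IsConeField C) {y : X} {A B u w : EuclideanSpace ℝ (Fin n)}
    (hA : A ∈ interior (range (𝓡∂ n))) (hB : B ∈ interior (range (𝓡∂ n)))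
    (hu : (A, u) ∈ chartCone C y) (hw : (B, w) ∈ chartCone C y)
    (hd : ∀ s ∈ Icc (0 : ℝ) 1, (A + s • (B - A), B - A) ∈ chartCone C y) :
    ConeJoins C ((extChartAt (𝓡∂ n) y).symm A) (chartSymmDeriv y A u)
      ((extChartAt (𝓡∂ n) y).symm B) (chartSymmDeriv y B w) := by
  obtain ⟨O, hO, hOC, hCO⟩ := exists_isOpen_interior_chartCone h y
  have e₁ := eventually_parabola_mem hO (η := 0) (A := A) (u := u) (v := B - A) fun s hs => by
    have hd0 := hd 0 (by simp)
    rw [zero_smul, add_zero] at hd0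
    simpa [parabola] using hCO _ (chartCone_convex h hu hd0 hs) hA
  have e₂ := eventually_parabola_mem hO (η := 1) (A := A) (u := B - A) (v := B - A) fun s hs => by
    simpa [parabola] using
      hCO _ (hd s hs) ((𝓡∂ n).convex_range.interior.add_smul_sub_mem hA hB hs)
  have e₃ := eventually_parabola_mem hO (η := 0) (A := B) (u := B - A) (v := w) fun s hs => by
    have hd1 := hd 1 (by simp)
    rw [one_smul, add_sub_cancel] at hd1
    simpa [parabola] using hCO _ (chartCone_convex h hd1 hw hs) hB
  -- The middle velocity for which pieces of durations η, 1 - 2η and η, turning from u and then into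
  -- w, end exactly at B.
  let v : ℝ → EuclideanSpace ℝ (Fin n) := fun η => (1 - η)⁻¹ • (B - A - (η / 2) • (u + w))
  have hv : ContinuousAt v 0 := by
    unfold v
    fun_prop (disch := norm_num)
  have hv0 : v 0 = B - A := by simp [v]
  have t₁ : Tendsto (fun η : ℝ => (η, A, u, v η)) (𝓝[>] 0) (𝓝 (0, A, u, B - A)) := by
    have : ContinuousAt (fun η : ℝ => (η, A, u, v η)) 0 := by fun_prop
    simpa [ContinuousAt, hv0] using this.mono_left nhdsWithin_le_nhds
  have t₂ : Tendsto (fun η : ℝ => (1 - 2 * η, A + (η / 2) • (u + v η), v η, v η)) (𝓝[>] 0)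
      (𝓝 (1, A, B - A, B - A)) := by
    have : ContinuousAt (fun η : ℝ => (1 - 2 * η, A + (η / 2) • (u + v η), v η, v η)) 0 := by
      fun_prop
    simpa [ContinuousAt, hv0] using this.mono_left nhdsWithin_le_nhds
  have t₃ : Tendsto (fun η : ℝ => (η, A + (η / 2) • (u + v η) + ((1 - 2 * η) / 2) • (v η + v η),
      v η, w)) (𝓝[>] 0) (𝓝 (0, B, B - A, w)) := by
    have : ContinuousAt (fun η : ℝ => (η, A + (η / 2) • (u + v η) +
      ((1 - 2 * η) / 2) • (v η + v η), v η, w)) 0 := by fun_prop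
    have h0 : A + (0 / 2 : ℝ) • (u + v 0) + ((1 - 2 * 0) / 2 : ℝ) • (v 0 + v 0) = B := by
      rw [hv0]
      module
    have t := this.tendsto.mono_left (nhdsWithin_le_nhds (s := Ioi 0))
    rwa [h0, hv0] at t
  obtain ⟨η, ⟨⟨⟨h₁, h₂⟩, h₃⟩, hη⟩, hη1⟩ := (((((t₁.eventually e₁).and (t₂.eventually e₂)).and
    (t₃.eventually e₃)).and self_mem_nhdsWithin).and
    (mem_nhdsWithin_of_mem_nhds (Iio_mem_nhds (one_half_pos (α := ℝ))))).exists
  have hη : 0 < η := hη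
  have hη1 : η < 1 / 2 := hη1
  have hve : (1 - η) • v η = B - A - (η / 2) • (u + w) := by
    unfold v
    rw [smul_smul, mul_inv_cancel₀ (by linarith), one_smul]
  have hend : A + (η / 2) • (u + v η) + ((1 - 2 * η) / 2) • (v η + v η) + (η / 2) • (v η + w) =
      B := by
    have : A + (η / 2) • (u + v η) + ((1 - 2 * η) / 2) • (v η + v η) + (η / 2) • (v η + w) =
      A + (η / 2) • (u + w) + (1 - η) • v η := by module
    rw [this, hve]
    module
  have j₁ := ConeJoins.parabola hη fun s hs => hOC (h₁ s hs)
  have j₂ := ConeJoins.parabola (by linarith) fun s hs => hOC (h₂ s hs)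
  have j₃ := ConeJoins.parabola hη fun s hs => hOC (h₃ s hs)
  dsimp only at j₁ j₂ j₃
  rw [hend] at j₃
  exact (j₁.trans j₂).trans j₃

end Bridge

/-! ### Openness and transitivity of the relation defined by a cone field -/

section Chronology

open Set Filter

variable {n : ℕ} [NeZero n] {X : Type*} [TopologicalSpace X]
  [ChartedSpace (EuclideanHalfSpace n) X]
  {C : X → Set (EuclideanSpace ℝ (Fin n))} {γ : ℝ → X} {V : ℝ → EuclideanSpace ℝ (Fin n)}
  {a b : ℝ} {x y z : X}

theorem IsConeCurve.before (h : IsConeCurve C γ V a b) {s t : ℝ} (hs : a ≤ s) (ht : t ≤ b)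
    (hst : s < t) : ConeBefore C (γ s) (γ t) :=
  ⟨_, _, h.joins hs ht hst⟩

/-- The manifold derivative at t is by definition taken in the chart centred at `γ t`, so no change
of coordinates enters. -/
theorem IsConeCurve.hasDerivWithinAt (h : IsConeCurve C γ V a b) {t : ℝ} (ht : t ∈ Icc a b) :
    HasDerivWithinAt (fun s => extChartAt (𝓡∂ n) (γ t) (γ s)) (V t) (Icc a b) t := by
  have h1 := (h.hasMFDerivWithinAt t ht).2
  simp only [writtenInExtChartAt, extChartAt_model_space_eq_id, PartialEquiv.refl_coe,
    PartialEquiv.refl_symm, Function.comp_id, preimage_id, id, modelWithCornersSelf_coe, range_id,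
    inter_univ] at h1
  exact hasDerivWithinAt_iff_hasFDerivWithinAt.2 h1

theorem tendsto_slope_right {E : Type*} [NormedAddCommGroup E] [NormedSpace ℝ E] {P : ℝ → E}
    {v : E} (hab : a < b) (h : HasDerivWithinAt P v (Icc a b) a) :
    Tendsto (fun δ => δ⁻¹ • (P (a + δ) - P a)) (𝓝[>] 0) (𝓝 v) := by
  have h1 := hasDerivWithinAt_iff_tendsto_slope.1 h
  have h2 : Tendsto (fun δ : ℝ => a + δ) (𝓝[>] 0) (𝓝[Icc a b \ {a}] a) := by
    refine tendsto_nhdsWithin_iff.2 ⟨?_, ?_⟩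
    · have : ContinuousAt (fun δ : ℝ => a + δ) 0 := by fun_prop
      simpa [ContinuousAt] using this.mono_left nhdsWithin_le_nhds
    · filter_upwards [self_mem_nhdsWithin,
        mem_nhdsWithin_of_mem_nhds (Iio_mem_nhds (sub_pos.2 hab))] with δ h1 h2
      simp only [mem_Ioi, mem_Iio] at h1 h2
      exact ⟨⟨by linarith, by linarith⟩, by simpa using h1.ne'⟩
  refine (h1.comp h2).congr fun δ => ?_
  simp [slope]

theorem tendsto_slope_left {E : Type*} [NormedAddCommGroup E] [NormedSpace ℝ E] {P : ℝ → E}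
    {v : E} (hab : a < b) (h : HasDerivWithinAt P v (Icc a b) b) :
    Tendsto (fun δ => δ⁻¹ • (P b - P (b - δ))) (𝓝[>] 0) (𝓝 v) := by
  have h1 := hasDerivWithinAt_iff_tendsto_slope.1 h
  have h2 : Tendsto (fun δ : ℝ => b - δ) (𝓝[>] 0) (𝓝[Icc a b \ {b}] b) := by
    refine tendsto_nhdsWithin_iff.2 ⟨?_, ?_⟩
    · have : ContinuousAt (fun δ : ℝ => b - δ) 0 := by fun_prop
      simpa [ContinuousAt] using this.mono_left nhdsWithin_le_nhds
    · filter_upwards [self_mem_nhdsWithin,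
        mem_nhdsWithin_of_mem_nhds (Iio_mem_nhds (sub_pos.2 hab))] with δ h1 h2
      simp only [mem_Ioi, mem_Iio] at h1 h2
      exact ⟨⟨by linarith, by linarith⟩, by simpa using h1.ne'⟩
  refine (h1.comp h2).congr fun δ => ?_
  simp only [Function.comp_apply, slope, vsub_eq_sub]
  rw [← neg_sub (P b), smul_neg, ← neg_smul, ← inv_neg]
  congr 2
  ring

/-- Near a point of the cone field, segments with nearly the same direction lie in the cones. -/
theorem exists_ball_segment_mem_chartCone (h : IsConeField C) {y : X}
    {z v : EuclideanSpace ℝ (Fin n)} (hv : (z, v) ∈ chartCone C y) :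
    ∃ r > 0, ∀ A ∈ Metric.ball z r ∩ range (𝓡∂ n), ∀ B ∈ Metric.ball z r ∩ range (𝓡∂ n),
      ∀ δ > (0 : ℝ), δ⁻¹ • (B - A) ∈ Metric.ball v r →
      ∀ s ∈ Icc (0 : ℝ) 1, (A + s • (B - A), B - A) ∈ chartCone C y := by
  obtain ⟨O, hO, hCO⟩ := h.exists_isOpen y
  have hvO : (z, v) ∈ O := by
    rw [hCO] at hv
    exact hv.1
  obtain ⟨r, hr, hball⟩ := Metric.isOpen_iff.1 hO _ hvO
  rw [← ball_prod_same] at hball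
  refine ⟨r, hr, fun A hA B hB δ hδ hd s hs => ?_⟩
  have h1 : (A + s • (B - A), δ⁻¹ • (B - A)) ∈ chartCone C y := by
    rw [hCO]
    exact ⟨hball ⟨(convex_ball z r).add_smul_sub_mem hA.1 hB.1 hs, hd⟩,
      (𝓡∂ n).convex_range.add_smul_sub_mem hA.2 hB.2 hs, trivial⟩
  have h2 := smul_mem_chartCone h h1 hδ
  rwa [smul_inv_smul₀ hδ.ne'] at h2

theorem extChartAt_mem_range (y p : X) : extChartAt (𝓡∂ n) y p ∈ range (𝓡∂ n) := by
  simp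

variable [IsManifold (𝓡∂ n) 1 X]

theorem extChartAt_mem_interior_range {y p : X} (hp : p ∈ (extChartAt (𝓡∂ n) y).source)
    (hpi : p ∈ (𝓡∂ n).interior X) : extChartAt (𝓡∂ n) y p ∈ interior (range (𝓡∂ n)) := by
  rw [extChartAt_source] at hp
  exact interior_mono (extChartAt_target_subset_range y)
    (((𝓡∂ n).isInteriorPoint_iff_of_mem_atlas one_ne_zero (chart_mem_atlas _ y) hp).1 hpi)

/-- The curve is cut shortly before its end and redirected to y' along a chart segment. The cut
point is interior, which allows the bending there; the arrival velocity is left free because y' may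
be a boundary point. -/
theorem ConeBefore.eventually (h : IsConeField C) (hxy : ConeBefore C x y) :
    ∀ᶠ y' in 𝓝 y, ConeBefore C x y' := by
  obtain ⟨u, w, a, b, γ, V, hab, hγ, rfl, rfl, rfl, rfl⟩ := hxy
  have hb : b ∈ Icc a b := right_mem_Icc.2 hab.le
  set φ := extChartAt (𝓡∂ n) (γ b) with hφ
  have hder : HasDerivWithinAt (φ ∘ γ) (V b) (Icc a b) b := hγ.hasDerivWithinAt hb
  obtain ⟨r, hr, hball⟩ :=
    exists_ball_segment_mem_chartCone h (mem_chartCone_self (hγ.mem b hb))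
  have hcφ : ContinuousAt φ (γ b) := continuousAt_extChartAt (γ b)
  have hsub : Tendsto (fun δ : ℝ => b - δ) (𝓝[>] 0) (𝓝[Icc a b] b) := by
    refine tendsto_nhdsWithin_iff.2 ⟨?_, ?_⟩
    · have : ContinuousAt (fun δ : ℝ => b - δ) 0 := by fun_prop
      simpa [ContinuousAt] using this.mono_left nhdsWithin_le_nhds
    · filter_upwards [self_mem_nhdsWithin,
        mem_nhdsWithin_of_mem_nhds (Iio_mem_nhds (sub_pos.2 hab))] with δ h1 h2
      simp only [mem_Ioi, mem_Iio] at h1 h2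
      exact ⟨by linarith, by linarith⟩
  have hγt : Tendsto (fun δ : ℝ => γ (b - δ)) (𝓝[>] 0) (𝓝 (γ b)) :=
    (hγ.continuousOn b hb).tendsto.comp hsub
  obtain ⟨δ, ⟨⟨⟨hδ₁, hδ₂⟩, hδ₃⟩, hδ⟩, hδb⟩ :=
    (((((tendsto_slope_left hab hder).eventually (Metric.ball_mem_nhds _ hr)).and
      ((hcφ.tendsto.comp hγt).eventually (Metric.ball_mem_nhds _ hr))).and
      (hγt.eventually (extChartAt_source_mem_nhds (I := 𝓡∂ n) (γ b)))).and
      self_mem_nhdsWithin |>.and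
      (mem_nhdsWithin_of_mem_nhds (Iio_mem_nhds (sub_pos.2 hab)))).exists
  have hδ : 0 < δ := hδ
  have hδb : δ < b - a := hδb
  have hpi : γ (b - δ) ∈ (𝓡∂ n).interior X :=
    h.interior (hγ.before le_rfl (by linarith) (by linarith : a < b - δ))
      (hγ.before (by linarith) le_rfl (by linarith : b - δ < b))
  obtain ⟨u, hu, huV⟩ := exists_mem_chartCone hδ₃
    (hγ.mem (b - δ) ⟨by linarith, by linarith⟩)
  -- With δ now fixed, the slope towards y' varies continuously and stays in the ball of admissible
  -- directions.
  have hslope : ContinuousAt (fun y' => δ⁻¹ • (φ y' - φ (γ (b - δ)))) (γ b) := by fun_prop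
  filter_upwards [hslope.tendsto.eventually (Metric.isOpen_ball.mem_nhds hδ₁),
    hcφ.tendsto.eventually (Metric.ball_mem_nhds _ hr),
    extChartAt_source_mem_nhds (I := 𝓡∂ n) (γ b)] with y' hy₁ hy₂ hy₃
  obtain ⟨v, hv⟩ := exists_coneJoins_of_segment h (extChartAt_mem_interior_range hδ₃ hpi)
    (extChartAt_mem_range (γ b) y') hu
    (hball _ ⟨hδ₂, extChartAt_mem_range _ _⟩ _ ⟨hy₂, extChartAt_mem_range _ _⟩ δ hδ hy₁)
  rw [huV, (extChartAt (𝓡∂ n) (γ b)).left_inv hδ₃, (extChartAt (𝓡∂ n) (γ b)).left_inv hy₃] at hv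
  exact ⟨_, _, (hγ.joins le_rfl (by linarith) (by linarith : a < b - δ)).trans hv⟩

/-- The corner at y is cut off by a segment from `γ (b - δ)` to `β (c + δ)`. Its slope tends to the
sum of the two velocities at y, which is in the cone by convexity. -/
theorem ConeBefore.trans (h : IsConeField C) (hxy : ConeBefore C x y) (hyz : ConeBefore C y z) :
    ConeBefore C x z := by
  have hyi := h.interior hxy hyz
  obtain ⟨-, -, a, b, γ, V, hab, hγ, rfl, -, rfl, -⟩ := hxy
  obtain ⟨-, -, c, d, β, W, hcd, hβ, hβc, -, rfl, -⟩ := hyz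
  have hb : b ∈ Icc a b := right_mem_Icc.2 hab.le
  have hc : c ∈ Icc c d := left_mem_Icc.2 hcd.le
  set φ := extChartAt (𝓡∂ n) (γ b) with hφ
  have hder₁ : HasDerivWithinAt (φ ∘ γ) (V b) (Icc a b) b := hγ.hasDerivWithinAt hb
  have hder₂ : HasDerivWithinAt (φ ∘ β) (W c) (Icc c d) c := by
    rw [hφ, ← hβc]
    exact hβ.hasDerivWithinAt hc
  have hW : W c ∈ C (γ b) := hβc ▸ hβ.mem c hc
  obtain ⟨r, hr, hball⟩ := exists_ball_segment_mem_chartCone h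
    (chartCone_add h (mem_chartCone_self (hγ.mem b hb)) (mem_chartCone_self hW))
  have hcφ : ContinuousAt φ (γ b) := continuousAt_extChartAt (γ b)
  have hsub : Tendsto (fun δ : ℝ => b - δ) (𝓝[>] 0) (𝓝[Icc a b] b) := by
    refine tendsto_nhdsWithin_iff.2 ⟨?_, ?_⟩
    · have : ContinuousAt (fun δ : ℝ => b - δ) 0 := by fun_prop
      simpa [ContinuousAt] using this.mono_left nhdsWithin_le_nhds
    · filter_upwards [self_mem_nhdsWithin,
        mem_nhdsWithin_of_mem_nhds (Iio_mem_nhds (sub_pos.2 hab))] with δ h1 h2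
      simp only [mem_Ioi, mem_Iio] at h1 h2
      exact ⟨by linarith, by linarith⟩
  have hadd : Tendsto (fun δ : ℝ => c + δ) (𝓝[>] 0) (𝓝[Icc c d] c) := by
    refine tendsto_nhdsWithin_iff.2 ⟨?_, ?_⟩
    · have : ContinuousAt (fun δ : ℝ => c + δ) 0 := by fun_prop
      simpa [ContinuousAt] using this.mono_left nhdsWithin_le_nhds
    · filter_upwards [self_mem_nhdsWithin,
        mem_nhdsWithin_of_mem_nhds (Iio_mem_nhds (sub_pos.2 hcd))] with δ h1 h2
      simp only [mem_Ioi, mem_Iio] at h1 h2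
      exact ⟨by linarith, by linarith⟩
  have hγt : Tendsto (fun δ : ℝ => γ (b - δ)) (𝓝[>] 0) (𝓝 (γ b)) :=
    (hγ.continuousOn b hb).tendsto.comp hsub
  have hβt : Tendsto (fun δ : ℝ => β (c + δ)) (𝓝[>] 0) (𝓝 (γ b)) := by
    rw [← hβc]
    exact (hβ.continuousOn c hc).tendsto.comp hadd
  have hslope : Tendsto (fun δ : ℝ => δ⁻¹ • (φ (β (c + δ)) - φ (γ (b - δ)))) (𝓝[>] 0)
      (𝓝 (V b + W c)) := by
    refine ((tendsto_slope_left hab hder₁).add (tendsto_slope_right hcd hder₂)).congr fun δ => ?_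
    simp only [Function.comp_apply, hβc]
    module
  have hnhds : (extChartAt (𝓡∂ n) (γ b)).source ∩ (𝓡∂ n).interior X ∩
      φ ⁻¹' Metric.ball (φ (γ b)) r ∈ 𝓝 (γ b) :=
    inter_mem (inter_mem (extChartAt_source_mem_nhds (I := 𝓡∂ n) (γ b))
      (((𝓡∂ n).isOpen_interior one_ne_zero).mem_nhds hyi)) (hcφ (Metric.ball_mem_nhds _ hr))
  obtain ⟨δ, ⟨⟨⟨⟨⟨hδ₁, hi₁⟩, hr₁⟩, ⟨⟨hδ₂, hi₂⟩, hr₂⟩⟩, hδ₃⟩, hδ⟩, hδb, hδd⟩ :=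
    ((((hγt.eventually hnhds).and (hβt.eventually hnhds)).and
      (hslope.eventually (Metric.ball_mem_nhds _ hr))).and
      self_mem_nhdsWithin |>.and (Filter.Eventually.and (mem_nhdsWithin_of_mem_nhds (Iio_mem_nhds (sub_pos.2 hab)))
        (mem_nhdsWithin_of_mem_nhds (Iio_mem_nhds (sub_pos.2 hcd))))).exists
  have hδ : 0 < δ := hδ
  have hδb : δ < b - a := hδb
  have hδd : δ < d - c := hδd
  obtain ⟨u, hu, huV⟩ := exists_mem_chartCone hδ₁ (hγ.mem (b - δ) ⟨by linarith, by linarith⟩)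
  obtain ⟨w, hw, hwW⟩ := exists_mem_chartCone hδ₂ (hβ.mem (c + δ) ⟨by linarith, by linarith⟩)
  have hj := coneJoins_of_segment h (extChartAt_mem_interior_range hδ₁ hi₁)
    (extChartAt_mem_interior_range hδ₂ hi₂) hu hw
    (hball _ ⟨hr₁, extChartAt_mem_range _ _⟩ _ ⟨hr₂, extChartAt_mem_range _ _⟩ δ hδ hδ₃)
  rw [huV, hwW, (extChartAt (𝓡∂ n) (γ b)).left_inv hδ₁,
    (extChartAt (𝓡∂ n) (γ b)).left_inv hδ₂] at hj
  exact ⟨_, _, ((hγ.joins le_rfl (by linarith) (by linarith : a < b - δ)).trans hj).trans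
    (hβ.joins (by linarith) le_rfl (by linarith : c + δ < d))⟩

theorem mem_closure_future (h : IsConeField C) (hx : x ∈ (𝓡∂ n).interior X)
    {v : EuclideanSpace ℝ (Fin n)} (hv : v ∈ C x) : x ∈ closure {y | ConeBefore C x y} := by
  set A := extChartAt (𝓡∂ n) x x with hA
  have hAi : A ∈ interior (range (𝓡∂ n)) :=
    extChartAt_mem_interior_range (mem_extChartAt_source x) hx
  obtain ⟨O, hO, hOC, hCO⟩ := exists_isOpen_interior_chartCone h x
  have e := eventually_parabola_mem hO (η := 0) (A := A) (u := v) (v := v) fun s hs => by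
    have h0 : parabola 0 A v v s = (A, v) := by simp [parabola]
    rw [h0]
    exact hCO _ (mem_chartCone_self hv) hAi
  have t : Tendsto (fun η : ℝ => (η, A, v, v)) (𝓝[>] 0) (𝓝 (0, A, v, v)) := by
    have : ContinuousAt (fun η : ℝ => (η, A, v, v)) 0 := by fun_prop
    exact this.tendsto.mono_left nhdsWithin_le_nhds
  have t' : Tendsto (fun η : ℝ => (extChartAt (𝓡∂ n) x).symm (A + (η / 2) • (v + v))) (𝓝[>] 0)
      (𝓝 x) := by
    have h1 : ContinuousAt (fun η : ℝ => A + (η / 2) • (v + v)) 0 := by fun_prop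
    have h2 := h1.tendsto
    rw [zero_div, zero_smul, add_zero] at h2
    have h3 : ContinuousAt (extChartAt (𝓡∂ n) x).symm A := continuousAt_extChartAt_symm x
    have h4 := (h3.tendsto.comp h2).mono_left (nhdsWithin_le_nhds (s := Ioi 0))
    rwa [hA, extChartAt_to_inv] at h4
  refine mem_closure_of_tendsto t' ?_
  filter_upwards [t.eventually e, self_mem_nhdsWithin] with η hη hη0
  have hj := ConeJoins.parabola (C := C) (y := x) hη0 fun s hs => hOC (hη s hs)
  rw [hA, extChartAt_to_inv] at hj
  exact ⟨_, _, hj⟩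

end Chronology

/-! ### The Riemannian metric and the differential in charts -/

section ChartMetric

open Set Filter MorseGeometry

variable {n : ℕ} [NeZero n] {X : Type*} [TopologicalSpace X]
  [ChartedSpace (EuclideanHalfSpace n) X]

/-- The differential of `f` in the preferred chart at `y`. -/
noncomputable def chartDifferential (f : X → ℝ) (y : X) (z : EuclideanSpace ℝ (Fin n)) :
    EuclideanSpace ℝ (Fin n) →L[ℝ] ℝ :=
  ContinuousLinearMap.comp (M₂ := EuclideanSpace ℝ (Fin n))
    (differential (n := n) f ((extChartAt (𝓡∂ n) y).symm z)) (chartSymmDeriv y z)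

variable [IsManifold (𝓡∂ n) ∞ X]

/-- The metric `h` in the preferred chart at `y`. -/
noncomputable def chartMetric (h : SmoothRiemannianMetric n X) (y : X)
    (z : EuclideanSpace ℝ (Fin n)) :
    EuclideanSpace ℝ (Fin n) →L[ℝ] EuclideanSpace ℝ (Fin n) →L[ℝ] ℝ :=
  ContinuousLinearMap.bilinearComp (E := EuclideanSpace ℝ (Fin n))
    (F := EuclideanSpace ℝ (Fin n)) (h.inner ((extChartAt (𝓡∂ n) y).symm z))
    (chartSymmDeriv y z) (chartSymmDeriv y z)

theorem chartDifferential_eq_fderivWithin {f : X → ℝ} (hf : ContMDiff (𝓡∂ n) 𝓘(ℝ, ℝ) ∞ f) (y : X)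
    {z : EuclideanSpace ℝ (Fin n)} (hz : z ∈ (extChartAt (𝓡∂ n) y).target) :
    chartDifferential f y z =
      fderivWithin ℝ (f ∘ (extChartAt (𝓡∂ n) y).symm) (extChartAt (𝓡∂ n) y).target z := by
  have h1 := (hf.mdifferentiable (by simp) ((extChartAt (𝓡∂ n) y).symm z)).hasMFDerivAt
  have h2 := (mdifferentiableWithinAt_extChartAt_symm hz).hasMFDerivWithinAt
  have h3 := h1.comp_hasMFDerivWithinAt z (h2.mono (extChartAt_target_subset_range y))
  have h4 : HasFDerivWithinAt (f ∘ (extChartAt (𝓡∂ n) y).symm) (chartDifferential f y z)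
      (extChartAt (𝓡∂ n) y).target z := hasMFDerivWithinAt_iff_hasFDerivWithinAt.1 h3
  exact (h4.fderivWithin (uniqueDiffOn_extChartAt_target y z hz)).symm

theorem contDiffOn_comp_extChartAt_symm {f : X → ℝ} (hf : ContMDiff (𝓡∂ n) 𝓘(ℝ, ℝ) ∞ f) (y : X) :
    ContDiffOn ℝ ∞ (f ∘ (extChartAt (𝓡∂ n) y).symm) (extChartAt (𝓡∂ n) y).target :=
  (hf.comp_contMDiffOn (contMDiffOn_extChartAt_symm y)).contDiffOn

theorem continuousOn_chartDifferential {f : X → ℝ} (hf : ContMDiff (𝓡∂ n) 𝓘(ℝ, ℝ) ∞ f) (y : X) :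
    ContinuousOn (chartDifferential f y) (extChartAt (𝓡∂ n) y).target :=
  ((contDiffOn_comp_extChartAt_symm hf y).continuousOn_fderivWithin
    (uniqueDiffOn_extChartAt_target y) (by simp)).congr
    fun _ hz => chartDifferential_eq_fderivWithin hf y hz

/-- The derivative of the inverse chart is the inverse of the tangent bundle trivialization, which
is continuous. -/
theorem continuousOn_chartSymmDeriv (y : X) (v : EuclideanSpace ℝ (Fin n)) :
    ContinuousOn (fun z => (Bundle.TotalSpace.mk' (EuclideanSpace ℝ (Fin n))
      ((extChartAt (𝓡∂ n) y).symm z) (chartSymmDeriv y z v) : TangentBundle (𝓡∂ n) X))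
      (extChartAt (𝓡∂ n) y).target := by
  have h1 := (trivializationAt (EuclideanSpace ℝ (Fin n)) (TangentSpace (𝓡∂ n)) y).continuousOn_symm
  have h2 : ContinuousOn (fun z => ((extChartAt (𝓡∂ n) y).symm z, v))
      (extChartAt (𝓡∂ n) y).target :=
    (continuousOn_extChartAt_symm y).prodMk continuousOn_const
  have hs : ∀ z ∈ (extChartAt (𝓡∂ n) y).target,
      (extChartAt (𝓡∂ n) y).symm z ∈ (chartAt (EuclideanHalfSpace n) y).source := fun z hz => by
    rw [← extChartAt_source (𝓡∂ n)]
    exact (extChartAt (𝓡∂ n) y).map_target hz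
  refine (h1.comp h2 fun z hz => ⟨by simpa using hs z hz, trivial⟩).congr fun z hz => ?_
  have h3 := TangentBundle.symmL_trivializationAt (I := 𝓡∂ n) (hs z hz)
  rw [(extChartAt (𝓡∂ n) y).right_inv hz] at h3
  have h4 := DFunLike.congr_fun h3 v
  simp only [Function.comp_apply]
  congr 1
  rw [Bundle.Trivialization.symmL_apply _ (by simpa using hs z hz)] at h4
  exact h4.symm

theorem continuousOn_chartMetric (h : SmoothRiemannianMetric n X) (y : X) :
    ContinuousOn (chartMetric h y) (extChartAt (𝓡∂ n) y).target := by
  refine continuousOn_clm_apply.2 fun v => continuousOn_clm_apply.2 fun w => ?_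
  have h1 := (h.contMDiff.continuous.comp_continuousOn
    (continuousOn_extChartAt_symm (I := 𝓡∂ n) y))
  have h2 := ContinuousOn.clm_bundle_apply₂ (F₃ := ℝ) (E₃ := Bundle.Trivial X ℝ) h1
    (continuousOn_chartSymmDeriv y v) (continuousOn_chartSymmDeriv y w)
  have h3 : Continuous (fun p : Bundle.TotalSpace ℝ (Bundle.Trivial X ℝ) => p.2) :=
    continuous_snd.comp (Bundle.Trivial.homeomorphProd X ℝ).continuous
  exact h3.comp_continuousOn h2

theorem chartMetric_pos (h : SmoothRiemannianMetric n X) {y : X} {z : EuclideanSpace ℝ (Fin n)}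
    (hz : z ∈ (extChartAt (𝓡∂ n) y).target) {v : EuclideanSpace ℝ (Fin n)} (hv : v ≠ 0) :
    0 < chartMetric h y z v v := by
  refine h.pos _ _ fun h0 => hv ?_
  have h1 : (mfderivWithin 𝓘(ℝ, EuclideanSpace ℝ (Fin n)) (𝓡∂ n) (extChartAt (𝓡∂ n) y).symm
    (range (𝓡∂ n)) z).IsInvertible := isInvertible_mfderivWithin_extChartAt_symm hz
  exact h1.injective (h0.trans (map_zero _).symm)

/-- A positive definite bilinear form on a finite-dimensional space as an isomorphism onto the
dual space. -/
theorem isInvertible_of_posDef {E : Type*} [NormedAddCommGroup E] [NormedSpace ℝ E]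
    [FiniteDimensional ℝ E] (B : E →L[ℝ] E →L[ℝ] ℝ) (hB : ∀ v, v ≠ 0 → 0 < B v v) :
    B.IsInvertible := by
  have hinj : Function.Injective (B : E →ₗ[ℝ] E →L[ℝ] ℝ) := by
    rw [← LinearMap.ker_eq_bot, LinearMap.ker_eq_bot']
    intro v hv
    by_contra hne
    have h1 : B v v = 0 := DFunLike.congr_fun (F := E →L[ℝ] ℝ) hv v
    exact (hB v hne).ne' h1
  have hfin : Module.finrank ℝ E = Module.finrank ℝ (E →L[ℝ] ℝ) :=
    (Subspace.dual_finrank_eq (K := ℝ) (V := E)).symm.trans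
      (LinearMap.toContinuousLinearMap (𝕜 := ℝ) (E := E) (F' := ℝ)).finrank_eq
  have : FiniteDimensional ℝ (E →L[ℝ] ℝ) :=
    Module.Finite.equiv (LinearMap.toContinuousLinearMap (𝕜 := ℝ) (E := E) (F' := ℝ))
  let e := LinearEquiv.ofInjectiveOfFinrankEq (B : E →ₗ[ℝ] E →L[ℝ] ℝ) hinj hfin
  exact ⟨e.toContinuousLinearEquiv, rfl⟩

/-- The squared norm of the gradient, in the preferred chart at `y`. -/
noncomputable def chartNormSq (h : SmoothRiemannianMetric n X) (f : X → ℝ) (y : X)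
    (z : EuclideanSpace ℝ (Fin n)) : ℝ :=
  differential f ((extChartAt (𝓡∂ n) y).symm z) (gradient h f ((extChartAt (𝓡∂ n) y).symm z))

/-- The gradient is chosen pointwise; this coordinate formula, with the inverse metric, is what
makes its squared norm visibly continuous. -/
theorem chartNormSq_eq (h : SmoothRiemannianMetric n X) (f : X → ℝ) {y : X}
    {z : EuclideanSpace ℝ (Fin n)} (hz : z ∈ (extChartAt (𝓡∂ n) y).target) :
    chartNormSq h f y z =
      chartDifferential f y z ((chartMetric h y z).inverse (chartDifferential f y z)) := by
  have h1 : (mfderivWithin 𝓘(ℝ, EuclideanSpace ℝ (Fin n)) (𝓡∂ n) (extChartAt (𝓡∂ n) y).symm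
    (range (𝓡∂ n)) z).IsInvertible := isInvertible_mfderivWithin_extChartAt_symm hz
  obtain ⟨η, hη⟩ := h1.surjective (gradient h f ((extChartAt (𝓡∂ n) y).symm z))
  have h2 : chartMetric h y z η = chartDifferential f y z := by
    ext w
    refine Eq.trans ?_ (inner_gradient h f ((extChartAt (𝓡∂ n) y).symm z) (chartSymmDeriv y z w))
    rw [← hη]
    rfl
  have h3 : (chartMetric h y z).inverse (chartDifferential f y z) = η := by
    obtain ⟨e, he⟩ := isInvertible_of_posDef (chartMetric h y z) fun v hv => chartMetric_pos h hz hv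
    rw [← h2, ← he, ContinuousLinearMap.inverse_equiv]
    exact e.symm_apply_apply η
  rw [h3, chartNormSq, ← hη]
  rfl

theorem continuousOn_chartNormSq (h : SmoothRiemannianMetric n X) {f : X → ℝ}
    (hf : ContMDiff (𝓡∂ n) 𝓘(ℝ, ℝ) ∞ f) (y : X) :
    ContinuousOn (chartNormSq h f y) (extChartAt (𝓡∂ n) y).target := by
  have h1 : ContinuousOn (fun z => (chartMetric h y z).inverse) (extChartAt (𝓡∂ n) y).target := by
    intro z hz
    obtain ⟨e, he⟩ := isInvertible_of_posDef (chartMetric h y z) fun v hv => chartMetric_pos h hz hv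
    have h2 := (contDiffAt_map_inverse (𝕜 := ℝ) (n := 0) e).continuousAt
    rw [he] at h2
    exact h2.comp_continuousWithinAt (continuousOn_chartMetric h y z hz)
  have h2 := continuousOn_chartDifferential hf y
  exact (h2.clm_apply (h1.clm_apply h2)).congr fun z hz => chartNormSq_eq h f hz

end ChartMetric

/-! ### The cones of a Morse metric -/

section MorseCone

open Set Filter MorseGeometry

variable {n : ℕ} [NeZero n] {X : Type*} [TopologicalSpace X]
  [ChartedSpace (EuclideanHalfSpace n) X] [IsManifold (𝓡∂ n) ∞ X]

/-- The future timelike cones of the Morse metric. -/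
def morseCone (h : SmoothRiemannianMetric n X) (f : X → ℝ) (ζ : ℝ) (p : X) :
    Set (EuclideanSpace ℝ (Fin n)) :=
  {v | IsFutureTimelike (morseMetric h f ζ) (gradient h f) p v}

variable {h : SmoothRiemannianMetric n X} {f : X → ℝ} {ζ : ℝ} {V₀ V₁ : Set X}

theorem morseMetric_apply (p : X) (v w : TangentSpace (𝓡∂ n) p) :
    morseMetric h f ζ p v w = differential f p (gradient h f p) * h.inner p v w -
      ζ * (differential f p v * differential f p w) := rfl

theorem gradient_normSq_pos {p : X} {v : TangentSpace (𝓡∂ n) p} (hv : differential f p v ≠ 0) :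
    0 < differential f p (gradient h f p) := by
  rw [← inner_gradient h f p]
  refine h.pos p _ fun h0 => hv ?_
  rw [← inner_gradient h f p, h0]
  simp

/-- Here g(ξ, v) = -(ζ - 1) |ξ|² df(v), so ζ > 1 turns the orientation condition into df(v) > 0;
|ξ|² is positive as soon as df(v) ≠ 0. -/
theorem isFutureTimelike_iff (hζ : 1 < ζ) {p : X} {v : TangentSpace (𝓡∂ n) p} :
    IsFutureTimelike (morseMetric h f ζ) (gradient h f) p v ↔
      differential f p (gradient h f p) * h.inner p v v < ζ * differential f p v ^ 2 ∧
        0 < differential f p v := by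
  unfold IsFutureTimelike
  rw [morseMetric_apply, morseMetric_apply, inner_gradient]
  have h1 : differential f p (gradient h f p) * differential f p v -
      ζ * (differential f p (gradient h f p) * differential f p v) =
      -((ζ - 1) * (differential f p (gradient h f p) * differential f p v)) := by ring
  rw [h1, neg_lt_zero, mul_pos_iff_of_pos_left (sub_pos.2 hζ)]
  refine and_congr ⟨fun h => by linarith, fun h => by linarith⟩ ⟨fun hv => ?_, fun hv => ?_⟩
  · have h0 : differential f p v ≠ 0 := fun h0 => by simp [h0] at hv
    exact (pos_iff_pos_of_mul_pos hv).1 (gradient_normSq_pos h0)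
  · exact mul_pos (gradient_normSq_pos hv.ne') hv

theorem differential_pos_of_mem_morseCone (hζ : 1 < ζ) {p : X} {v : EuclideanSpace ℝ (Fin n)}
    (hv : v ∈ morseCone h f ζ p) : 0 < differential (n := n) f p v :=
  ((isFutureTimelike_iff hζ).1 hv).2

theorem gradient_mem_morseCone (hζ : 1 < ζ) {p : X} (hp : p ∉ criticalSet n f) :
    gradient h f p ∈ morseCone h f ζ p := by
  have h0 : ∃ v, differential (n := n) f p v ≠ 0 := by
    by_contra! h0
    exact hp (ContinuousLinearMap.ext h0)
  obtain ⟨v, hv⟩ := h0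
  have h1 := gradient_normSq_pos (h := h) hv
  refine (isFutureTimelike_iff hζ).2 ⟨?_, h1⟩
  rw [inner_gradient, ← sq]
  exact (lt_mul_iff_one_lt_left (pow_pos h1 2)).2 hζ

/-- Convexity of the cone `N * B v v < ζ * (D v) ^ 2`, `0 < D v`. -/
theorem convex_quadratic_cone {E : Type*} [AddCommGroup E] [Module ℝ E] (B : E →ₗ[ℝ] E →ₗ[ℝ] ℝ)
    (D : E →ₗ[ℝ] ℝ) {N ζ : ℝ} (hN : 0 ≤ N) (hsymm : ∀ v w, B v w = B w v) (hpos : ∀ v, 0 ≤ B v v) :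
    Convex ℝ {v | N * B v v < ζ * D v ^ 2 ∧ 0 < D v} := by
  rintro v ⟨hv, hv0⟩ w ⟨hw, hw0⟩ s t hs ht hst
  have hD : 0 < s * D v + t * D w := by
    rcases hs.eq_or_lt with rfl | hs
    · simpa [show t = 1 by linarith] using hw0
    · have := mul_pos hs hv0
      have := mul_nonneg ht hw0.le
      linarith
  -- The mixed term comes from B ≥ 0 on the vector D(w)v - D(v)w, which D annihilates.
  have hvw : N * B v w < ζ * (D v * D w) := by
    have h1 : 0 ≤ D w ^ 2 * B v v - 2 * (D v * D w) * B v w + D v ^ 2 * B w w := by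
      have := hpos (D w • v - D v • w)
      simp only [map_sub, map_smul, LinearMap.sub_apply, LinearMap.smul_apply, smul_eq_mul,
        hsymm w v] at this
      linarith
    have h2 := mul_nonneg hN h1
    have h3 := mul_lt_mul_of_pos_left hv (pow_pos hw0 2)
    have h4 := mul_lt_mul_of_pos_left hw (pow_pos hv0 2)
    have h5 := mul_pos hv0 hw0
    refine lt_of_mul_lt_mul_left (a := 2 * (D v * D w)) ?_ (by positivity)
    linarith
  refine ⟨?_, by simpa using hD⟩
  simp only [map_add, map_smul, LinearMap.add_apply, LinearMap.smul_apply, smul_eq_mul, hsymm w v]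
  have h6 : 0 < s ^ 2 ∨ 0 < t ^ 2 := by
    rcases hs.eq_or_lt with rfl | hs
    · right
      simp [show t = 1 by linarith]
    · left
      positivity
  have h7 : N * B v v * s ^ 2 ≤ ζ * D v ^ 2 * s ^ 2 :=
    mul_le_mul_of_nonneg_right hv.le (sq_nonneg s)
  have h8 : N * B w w * t ^ 2 ≤ ζ * D w ^ 2 * t ^ 2 :=
    mul_le_mul_of_nonneg_right hw.le (sq_nonneg t)
  have h9 : N * B v w * (s * t) ≤ ζ * (D v * D w) * (s * t) :=
    mul_le_mul_of_nonneg_right hvw.le (mul_nonneg hs ht)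
  rcases h6 with h6 | h6
  · have := mul_lt_mul_of_pos_right hv h6
    linarith
  · have := mul_lt_mul_of_pos_right hw h6
    linarith

theorem convex_futureTimelike (hζ : 1 < ζ) (p : X) : Convex ℝ {v : TangentSpace (𝓡∂ n) p |
    IsFutureTimelike (morseMetric h f ζ) (gradient h f) p v} := by
  have hnonneg : ∀ v, 0 ≤ h.inner p v v := fun v => by
    by_cases h0 : v = 0
    · simp [h0]
    · exact (h.pos p v h0).le
  have hN : 0 ≤ differential f p (gradient h f p) := by
    rw [← inner_gradient h f p]
    exact hnonneg _
  let B : TangentSpace (𝓡∂ n) p →ₗ[ℝ] TangentSpace (𝓡∂ n) p →ₗ[ℝ] ℝ :=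
    LinearMap.mk₂ ℝ (fun v w => h.inner p v w)
      (fun v₁ v₂ w => by simp) (fun c v w => by simp) (fun v w₁ w₂ => by simp)
      (fun c v w => by simp)
  have := convex_quadratic_cone B (differential f p).toLinearMap (ζ := ζ)
    hN (fun v w => h.symm p v w) hnonneg
  have heq : {v : TangentSpace (𝓡∂ n) p |
      IsFutureTimelike (morseMetric h f ζ) (gradient h f) p v} =
      {v | differential f p (gradient h f p) * B v v <
        ζ * (differential f p).toLinearMap v ^ 2 ∧ 0 < (differential f p).toLinearMap v} :=
    Set.ext fun v => isFutureTimelike_iff hζ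
  rwa [heq]

theorem convex_morseCone (hζ : 1 < ζ) (p : X) : Convex ℝ (morseCone h f ζ p) :=
  convex_futureTimelike hζ p

theorem IsFutureTimelike.smul (hζ : 1 < ζ) {p : X} {v : TangentSpace (𝓡∂ n) p}
    (hv : IsFutureTimelike (morseMetric h f ζ) (gradient h f) p v) {k : ℝ} (hk : 0 < k) :
    IsFutureTimelike (morseMetric h f ζ) (gradient h f) p (k • v) := by
  obtain ⟨h1, h2⟩ := (isFutureTimelike_iff hζ).1 hv
  refine (isFutureTimelike_iff hζ).2 ?_
  simp only [map_smul, smul_apply, smul_eq_mul]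
  have h3 := mul_lt_mul_of_pos_left h1 (pow_pos hk 2)
  exact ⟨by linarith, mul_pos hk h2⟩

theorem smul_mem_morseCone (hζ : 1 < ζ) {p : X} {v : EuclideanSpace ℝ (Fin n)}
    (hv : v ∈ morseCone h f ζ p) {k : ℝ} (hk : 0 < k) : k • v ∈ morseCone h f ζ p :=
  IsFutureTimelike.smul hζ hv hk

/-- In a chart the cone is cut out by strict inequalities between continuous functions over the
chart target, which is itself relatively open in the half-space. -/
theorem exists_isOpen_chartCone_morseCone (hζ : 1 < ζ) (hf : ContMDiff (𝓡∂ n) 𝓘(ℝ, ℝ) ∞ f) (y : X) :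
    ∃ O, IsOpen O ∧ chartCone (morseCone h f ζ) y = O ∩ (range (𝓡∂ n) ×ˢ univ) := by
  set T := (extChartAt (𝓡∂ n) y).target with hT
  have hmem : ∀ q : EuclideanSpace ℝ (Fin n) × EuclideanSpace ℝ (Fin n),
      q ∈ chartCone (morseCone h f ζ) y ↔ q.1 ∈ T ∧
        chartNormSq h f y q.1 * chartMetric h y q.1 q.2 q.2 <
          ζ * chartDifferential f y q.1 q.2 ^ 2 ∧ 0 < chartDifferential f y q.1 q.2 := fun q =>
    and_congr_right fun _ => isFutureTimelike_iff hζ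
  have hfst : ContinuousOn (Prod.fst : EuclideanSpace ℝ (Fin n) × EuclideanSpace ℝ (Fin n) → _)
      (T ×ˢ univ) := continuousOn_fst
  have hsnd : ContinuousOn (Prod.snd : EuclideanSpace ℝ (Fin n) × EuclideanSpace ℝ (Fin n) → _)
      (T ×ˢ univ) := continuousOn_snd
  have hmaps : MapsTo (Prod.fst : EuclideanSpace ℝ (Fin n) × EuclideanSpace ℝ (Fin n) → _)
      (T ×ˢ univ) T := fun q hq => hq.1
  have c₁ : ContinuousOn (fun q : EuclideanSpace ℝ (Fin n) × EuclideanSpace ℝ (Fin n) =>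
      chartDifferential f y q.1 q.2) (T ×ˢ univ) :=
    ((continuousOn_chartDifferential hf y).comp hfst hmaps).clm_apply hsnd
  have c₂ : ContinuousOn (fun q : EuclideanSpace ℝ (Fin n) × EuclideanSpace ℝ (Fin n) =>
      chartMetric h y q.1 q.2 q.2) (T ×ˢ univ) :=
    (((continuousOn_chartMetric h y).comp hfst hmaps).clm_apply hsnd).clm_apply hsnd
  have c₃ : ContinuousOn (fun q : EuclideanSpace ℝ (Fin n) × EuclideanSpace ℝ (Fin n) =>
      chartNormSq h f y q.1) (T ×ˢ univ) :=
    (continuousOn_chartNormSq h hf y).comp hfst hmaps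
  have c₄ : ContinuousOn (fun q : EuclideanSpace ℝ (Fin n) × EuclideanSpace ℝ (Fin n) =>
      (ζ * chartDifferential f y q.1 q.2 ^ 2 - chartNormSq h f y q.1 *
        chartMetric h y q.1 q.2 q.2, chartDifferential f y q.1 q.2)) (T ×ˢ univ) :=
    (((c₁.pow 2).const_smul ζ).sub (c₃.mul c₂)).prodMk c₁
  obtain ⟨O, hO, hOeq⟩ := continuousOn_iff'.1 c₄ (Ioi 0 ×ˢ Ioi 0) (isOpen_Ioi.prod isOpen_Ioi)
  obtain ⟨W, hW, hWeq⟩ : ∃ W, IsOpen W ∧ T = W ∩ range (𝓡∂ n) :=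
    ⟨_, (chartAt (EuclideanHalfSpace n) y).open_target.preimage (𝓡∂ n).continuous_symm,
      extChartAt_target (I := 𝓡∂ n) y⟩
  refine ⟨O ∩ W ×ˢ univ, hO.inter (hW.prod isOpen_univ), ?_⟩
  ext q
  have h1 := Set.ext_iff.1 hOeq q
  have h2 := Set.ext_iff.1 hWeq q.1
  simp only [mem_inter_iff, mem_preimage, mem_prod, mem_Ioi, sub_pos, mem_univ, and_true] at h1 h2
  rw [hmem]
  simp only [mem_inter_iff, mem_prod, mem_univ, and_true]
  tauto

theorem IsConeCurve.strictMonoOn (hf : ContMDiff (𝓡∂ n) 𝓘(ℝ, ℝ) ∞ f) (hζ : 1 < ζ) {γ : ℝ → X}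
    {V : ℝ → EuclideanSpace ℝ (Fin n)} {a b : ℝ} (hγ : IsConeCurve (morseCone h f ζ) γ V a b) :
    StrictMonoOn (f ∘ γ) (Icc a b) := by
  have hder : ∀ t ∈ Icc a b,
      HasDerivWithinAt (f ∘ γ) (differential (n := n) f (γ t) (V t)) (Icc a b) t := fun t ht => by
    have h1 := (hf.mdifferentiable (by simp) (γ t)).hasMFDerivAt
    have h2 := h1.comp_hasMFDerivWithinAt t (hγ.hasMFDerivWithinAt t ht)
    have h3 : HasFDerivWithinAt (f ∘ γ) (ContinuousLinearMap.toSpanSingleton ℝ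
        (differential (n := n) f (γ t) (V t))) (Icc a b) t := by
      refine hasMFDerivWithinAt_iff_hasFDerivWithinAt.1 (h2.congr_mfderiv ?_)
      refine ContinuousLinearMap.ext_ring ?_
      refine Eq.trans ?_ (one_smul ℝ _).symm
      exact congrArg (differential (n := n) f (γ t)) (one_smul ℝ (V t))
    exact hasDerivWithinAt_iff_hasFDerivWithinAt.2 h3
  refine strictMonoOn_of_hasDerivWithinAt_pos (convex_Icc a b)
    (fun t ht => (hder t ht).continuousWithinAt)
    (fun t ht => (hder t (interior_subset ht)).mono interior_subset) fun t ht => ?_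
  exact differential_pos_of_mem_morseCone hζ (hγ.mem t (interior_subset ht))

theorem ConeBefore.lt (hf : ContMDiff (𝓡∂ n) 𝓘(ℝ, ℝ) ∞ f) (hζ : 1 < ζ) {x y : X}
    (hxy : ConeBefore (morseCone h f ζ) x y) : f x < f y := by
  obtain ⟨-, -, a, b, γ, V, hab, hγ, rfl, -, rfl, -⟩ := hxy
  exact hγ.strictMonoOn hf hζ (left_mem_Icc.2 hab.le) (right_mem_Icc.2 hab.le) hab

omit [IsManifold (𝓡∂ n) ∞ X] in
theorem MorseGeometry.IsMorseFunction.mem_interior (hV : IsCobordism n X V₀ V₁) (hf : IsMorseFunction n V₀ V₁ f)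
    {p : X} (h0 : f p ≠ 0) (h1 : f p ≠ 1) : p ∈ (𝓡∂ n).interior X := by
  rw [← (𝓡∂ n).compl_boundary, ← hV.union_eq, ← hf.preimage_zero, ← hf.preimage_one]
  simp [h0, h1]

theorem isConeField_morseCone (hV : IsCobordism n X V₀ V₁) (hf : IsMorseFunction n V₀ V₁ f)
    (hζ : 1 < ζ) : IsConeField (morseCone h f ζ) where
  convex := convex_morseCone hζ
  smul_mem _ _ hv _ hk := smul_mem_morseCone hζ hv hk
  exists_isOpen := exists_isOpen_chartCone_morseCone hζ hf.contMDiff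
  interior {x y z} hxy hyz := by
    have h1 := hxy.lt hf.contMDiff hζ
    have h2 := hyz.lt hf.contMDiff hζ
    have h3 := (hf.mem_Icc x).1
    have h4 := (hf.mem_Icc z).2
    exact hf.mem_interior hV (by linarith) (by linarith)

end MorseCone

/-! ### Critical points of Morse functions and the chronology of a Morse geometry -/

section MorseGeometryChronology

open Set Filter MorseGeometry

variable {n : ℕ} [NeZero n] {X : Type*} [TopologicalSpace X]
  [ChartedSpace (EuclideanHalfSpace n) X] [IsManifold (𝓡∂ n) ∞ X]
  {h : SmoothRiemannianMetric n X} {f : X → ℝ} {ζ : ℝ} {V₀ V₁ : Set X}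

omit [IsManifold (𝓡∂ n) ∞ X] in
theorem chartDifferential_eq_zero_of_mem {p q : X} (hq : q ∈ (extChartAt (𝓡∂ n) p).source)
    (hqc : q ∈ criticalSet n f) : chartDifferential f p (extChartAt (𝓡∂ n) p q) = 0 := by
  unfold chartDifferential
  rw [(extChartAt (𝓡∂ n) p).left_inv hq, show differential (n := n) f q = 0 from hqc]
  exact ContinuousLinearMap.zero_comp (M₂ := EuclideanSpace ℝ (Fin n)) _

theorem isOpen_puncturedManifold (hf : ContMDiff (𝓡∂ n) 𝓘(ℝ, ℝ) ∞ f) :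
    IsOpen (puncturedManifold n f) := by
  refine isOpen_iff_mem_nhds.2 fun p hp => ?_
  have hne : chartDifferential f p (extChartAt (𝓡∂ n) p p) ≠ 0 := by
    unfold chartDifferential
    rw [extChartAt_to_inv, chartSymmDeriv_self]
    exact hp
  have hc : ContinuousOn (fun q => chartDifferential f p (extChartAt (𝓡∂ n) p q))
      (extChartAt (𝓡∂ n) p).source :=
    (continuousOn_chartDifferential hf p).comp (continuousOn_extChartAt p)
      (extChartAt (𝓡∂ n) p).mapsTo
  have hc' := hc.continuousAt (extChartAt_source_mem_nhds (I := 𝓡∂ n) p)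
  filter_upwards [hc'.eventually_ne hne, extChartAt_source_mem_nhds (I := 𝓡∂ n) p] with q hq hqs hqc
  exact hq (chartDifferential_eq_zero_of_mem hqs hqc)

theorem eventually_notMem_criticalSet (hf : IsMorseFunction n V₀ V₁ f) {p : X}
    (hp : p ∈ criticalSet n f) : ∀ᶠ q in 𝓝[≠] p, q ∉ criticalSet n f := by
  set φ := extChartAt (𝓡∂ n) p with hφ
  have hint : φ p ∈ interior φ.target :=
    ((𝓡∂ n).isInteriorPoint_iff_of_mem_atlas (n := ∞) (by simp) (chart_mem_atlas _ p)
      (mem_chart_source _ p)).1 (hf.critical_interior hp)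
  have hnhds : φ.target ∈ 𝓝 (φ p) := mem_interior_iff_mem_nhds.1 hint
  have hF : ContDiffAt ℝ ∞ (f ∘ φ.symm) (φ p) :=
    (contDiffOn_comp_extChartAt_symm hf.contMDiff p).contDiffAt hnhds
  have hd : HasFDerivAt (fderiv ℝ (f ∘ φ.symm)) (hessian n f p) (φ p) :=
    ((hF.fderiv_right (m := ∞) (by simp)).differentiableAt (by simp)).hasFDerivAt
  have hker : (hessian n f p : EuclideanSpace ℝ (Fin n) →ₗ[ℝ]
      EuclideanSpace ℝ (Fin n) →L[ℝ] ℝ).ker = ⊥ := by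
    rw [LinearMap.ker_eq_bot']
    intro v hv
    exact hf.nondegenerate p hp v fun w =>
      DFunLike.congr_fun (F := EuclideanSpace ℝ (Fin n) →L[ℝ] ℝ) hv w
  obtain ⟨K, -, hK⟩ := LinearMap.exists_antilipschitzWith _ hker
  -- Injectivity of the Hessian in finite dimension bounds it from below, so the differential
  -- vanishes nowhere else near p.
  have hev := hd.eventually_ne (c := 0) ⟨K, hK⟩
  have ht : Tendsto φ (𝓝[≠] p) (𝓝[≠] (φ p)) := by
    refine tendsto_nhdsWithin_iff.2
      ⟨(continuousAt_extChartAt p).tendsto.mono_left nhdsWithin_le_nhds, ?_⟩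
    filter_upwards [self_mem_nhdsWithin,
      mem_nhdsWithin_of_mem_nhds (extChartAt_source_mem_nhds (I := 𝓡∂ n) p)] with q hq hqs heq
    exact hq (φ.injOn hqs (mem_extChartAt_source p) heq)
  have ht' : Tendsto φ (𝓝[≠] p) (𝓝 (φ p)) := ht.mono_right nhdsWithin_le_nhds
  filter_upwards [ht.eventually hev, ht'.eventually (isOpen_interior.mem_nhds hint),
    mem_nhdsWithin_of_mem_nhds (extChartAt_source_mem_nhds (I := 𝓡∂ n) p)] with q h1 h2 h3 h4
  have h5 := chartDifferential_eq_zero_of_mem h3 h4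
  rw [chartDifferential_eq_fderivWithin hf.contMDiff p (interior_subset h2),
    fderivWithin_of_mem_nhds (mem_interior_iff_mem_nhds.1 h2)] at h5
  exact h1 h5

theorem finite_criticalSet [CompactSpace X] (hf : IsMorseFunction n V₀ V₁ f) :
    (criticalSet n f).Finite := by
  by_contra hinf
  obtain ⟨p, -, hp⟩ := Set.Infinite.exists_accPt_of_subset_isCompact hinf isCompact_univ
    (subset_univ _)
  rw [accPt_iff_frequently_nhdsNE] at hp
  refine hp ?_
  by_cases hpc : p ∈ criticalSet n f
  · exact eventually_notMem_criticalSet hf hpc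
  · exact mem_nhdsWithin_of_mem_nhds ((isOpen_puncturedManifold hf.contMDiff).mem_nhds hpc)

theorem exists_regular_level [CompactSpace X] (hV : IsCobordism n X V₀ V₁)
    (hf : IsMorseFunction n V₀ V₁ f) {a b : ℝ} (hab : a < b) :
    ∃ c, a < c ∧ c < b ∧ ∀ y, f y = c → y ∈ puncturedManifold n f ∧ y ∉ (𝓡∂ n).boundary X := by
  obtain ⟨c, hc, hcn⟩ := ((Ioo_infinite hab).sdiff
    -- Besides critical values, 0 and 1 are excluded to keep the level off the boundary.
    (((finite_criticalSet hf).image f).union (toFinite {0, 1}))).nonempty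
  refine ⟨c, hc.1, hc.2, ?_⟩
  rintro y rfl
  simp only [mem_union, mem_insert_iff, mem_singleton_iff, not_or] at hcn
  refine ⟨fun hy => hcn.1 (mem_image_of_mem f hy), fun hy => ?_⟩
  have := hf.mem_interior hV hcn.2.1 hcn.2.2
  rw [← (𝓡∂ n).compl_boundary] at this
  exact this hy

omit [IsManifold (𝓡∂ n) ∞ X] in
theorem toSpanSingleton_apply_one_eq {p : X} (L : ℝ →L[ℝ] TangentSpace (𝓡∂ n) p) :
    L = ContinuousLinearMap.toSpanSingleton ℝ (L 1) := by
  ext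
  simp

/-- Positivity of df on the cones keeps a curve away from critical points and between the levels of
its ends, so it lies in U as soon as U contains that slab of M. -/
theorem chronBefore_iff {U : Set X} (hf : ContMDiff (𝓡∂ n) 𝓘(ℝ, ℝ) ∞ f) (hζ : 1 < ζ) {x y : X}
    (hU : ∀ p ∈ puncturedManifold n f, f x ≤ f p → f p ≤ f y → p ∈ U) :
    ChronBefore (morseMetric h f ζ) (gradient h f) U x y ↔
      x ∈ U ∧ y ∈ U ∧ ConeBefore (morseCone h f ζ) x y := by
  constructor
  · rintro ⟨γ, rfl, rfl, hγ⟩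
    refine ⟨hγ.mapsTo (by simp), hγ.mapsTo (by simp), _, _, 0, 1, γ, fun t =>
      mfderivWithin 𝓘(ℝ, ℝ) (𝓡∂ n) γ (Icc 0 1) t (1 : ℝ), one_pos, ⟨fun t ht => ?_, hγ.timelike⟩,
      rfl, rfl, rfl, rfl⟩
    exact (hγ.mdifferentiableOn t ht).hasMFDerivWithinAt.congr_mfderiv
      (toSpanSingleton_apply_one_eq _)
  · rintro ⟨-, -, hxy⟩
    obtain ⟨γ, V, hγ, rfl, rfl⟩ := hxy.exists_unit fun p v hv k hk => smul_mem_morseCone hζ hv hk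
    have hmono := (hγ.strictMonoOn hf hζ).monotoneOn
    refine ⟨γ, rfl, rfl, fun t ht => ?_, fun t ht =>
      (hγ.hasMFDerivWithinAt t ht).mdifferentiableWithinAt, fun t ht => ?_⟩
    · refine hU _ (fun hc => ?_) (hmono (by simp) ht ht.1) (hmono ht (by simp) ht.2)
      have := differential_pos_of_mem_morseCone hζ (hγ.mem t ht)
      rw [show differential (n := n) f (γ t) = 0 from hc] at this
      exact lt_irrefl _ this
    · have hu : UniqueMDiffWithinAt 𝓘(ℝ, ℝ) (Icc (0 : ℝ) 1) t :=
        ((uniqueDiffOn_Icc one_pos) t ht).uniqueMDiffWithinAt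
      rw [(hγ.hasMFDerivWithinAt t ht).mfderivWithin hu]
      have h1 : ContinuousLinearMap.toSpanSingleton ℝ (V t) (1 : ℝ) = V t := one_smul ℝ (V t)
      have h2 := hγ.mem t ht
      rw [← h1] at h2
      exact h2

theorem ConeBefore.mem_puncturedManifold (hζ : 1 < ζ) {x y : X}
    (hxy : ConeBefore (morseCone h f ζ) x y) :
    x ∈ puncturedManifold n f ∧ y ∈ puncturedManifold n f := by
  obtain ⟨-, -, a, b, γ, V, hab, hγ, rfl, -, rfl, -⟩ := hxy
  have key : ∀ t ∈ Icc a b, γ t ∈ puncturedManifold n f := fun t ht hc => by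
    have := differential_pos_of_mem_morseCone hζ (hγ.mem t ht)
    rw [show differential (n := n) f (γ t) = 0 from hc] at this
    exact lt_irrefl _ this
  exact ⟨key a (left_mem_Icc.2 hab.le), key b (right_mem_Icc.2 hab.le)⟩

theorem isChronology_morseCone (hV : IsCobordism n X V₀ V₁) (hf : IsMorseFunction n V₀ V₁ f)
    (hζ : 1 < ζ) : IsChronology (ConeBefore (morseCone h f ζ)) f := by
  have hC : IsConeField (morseCone h f ζ) := isConeField_morseCone hV hf hζ
  refine ⟨fun h₁ h₂ => h₁.trans hC h₂, fun h₁ => h₁.lt hf.contMDiff hζ, fun x => ?_, fun y => ?_,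
    fun {x y} hxy => ?_, hf.contMDiff.continuous⟩
  · exact isOpen_iff_mem_nhds.2 fun y hy => ConeBefore.eventually hC hy
  · refine isOpen_iff_mem_nhds.2 fun x hx => ?_
    filter_upwards [ConeBefore.eventually hC.neg hx.neg] with x' hx'
    exact hx'.of_neg
  · obtain ⟨γ, V, hγ, h0, h1⟩ := hxy.exists_unit hC.smul_mem
    exact ⟨γ, hγ.continuousOn, h0, h1, fun s hs t ht hst => hγ.before hs.1 ht.2 hst⟩

theorem mem_closure_morseCone (hV : IsCobordism n X V₀ V₁) (hf : IsMorseFunction n V₀ V₁ f)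
    (hζ : 1 < ζ) {x : X} (hx : x ∈ puncturedManifold n f) (hxb : x ∉ (𝓡∂ n).boundary X) :
    x ∈ closure {y | ConeBefore (morseCone h f ζ) x y} ∧
      x ∈ closure {y | ConeBefore (morseCone h f ζ) y x} := by
  have hC : IsConeField (morseCone h f ζ) := isConeField_morseCone hV hf hζ
  have hxi : x ∈ (𝓡∂ n).interior X := by
    rw [← (𝓡∂ n).compl_boundary]
    exact hxb
  have hv := gradient_mem_morseCone (h := h) hζ hx
  refine ⟨mem_closure_future hC hxi hv, ?_⟩
  refine closure_mono (fun y hy => ?_) (mem_closure_future hC.neg hxi (neg_mem_neg.2 hv))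
  exact ConeBefore.of_neg hy

omit [IsManifold (𝓡∂ n) ∞ X] in
/-- Causal continuity as a pair of reflection properties. -/
theorem causallyContinuous_iff {g : MetricField n X} {T : MorseGeometry.VectorField n X} {U : Set X}
    (hU : IsOpen U) {r : X → X → Prop} (hr : ∀ x y, ChronBefore g T U x y ↔ r x y)
    (htrans : ∀ {x y z}, r x y → r y z → r x z) (hmem : ∀ {x y}, r x y → x ∈ U ∧ y ∈ U)
    (hpast : ∀ x, IsOpen {y | r y x}) (hfuture : ∀ x, IsOpen {y | r x y}) :
    CausallyContinuous g T U ↔ ∀ x ∈ U, x ∉ (𝓡∂ n).boundary X →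
      PastReflecting r U x ∧ PastReflecting (Function.swap r) U x := by
  obtain rfl : ChronBefore g T U = r := funext₂ fun x y => propext (hr x y)
  refine forall₃_congr fun x _ _ => and_congr ?_ ?_
  · exact past_eq_iff (r := ChronBefore g T U) (x := x) hU htrans (fun h => (hmem h).1) (hpast x)
  · exact past_eq_iff (r := Function.swap (ChronBefore g T U)) (x := x) hU (fun h₁ h₂ => htrans h₂ h₁)
      (fun h => (hmem h).2) (hfuture x)

end MorseGeometryChronology

/-! ### Assembling the equivalence -/

theorem mainTheorem3 {n : ℕ} [NeZero n] {X : Type*} [TopologicalSpace X] [T2Space X]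
    [CompactSpace X] [ChartedSpace (EuclideanHalfSpace n) X] [IsManifold (𝓡∂ n) ∞ X]
    (V₀ V₁ : Set X) (hV : MorseGeometry.IsCobordism n X V₀ V₁)
    (h : MorseGeometry.SmoothRiemannianMetric n X)
    (f : X → ℝ) (hf : MorseGeometry.IsMorseFunction n V₀ V₁ f)
    (ζ : ℝ) (hζ : 1 < ζ) (a b : ℝ) (hab : a < b)
    (M M₁ M₂ : Set X) (hM : M = MorseGeometry.puncturedManifold n f)
    (hM₁ : M₁ = M ∩ f ⁻¹' Set.Ico 0 b) (hM₂ : M₂ = M ∩ f ⁻¹' Set.Ioc a 1)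
    (g : MorseGeometry.MetricField n X) (hg : g = MorseGeometry.morseMetric h f ζ)
    (ξ : MorseGeometry.VectorField n X) (hξ : ξ = MorseGeometry.gradient h f) :
    M = M₁ ∪ M₂ ∧
    (MorseGeometry.CausallyContinuous g ξ M ↔
      MorseGeometry.CausallyContinuous g ξ M₁ ∧ MorseGeometry.CausallyContinuous g ξ M₂) := by
  subst hM hM₁ hM₂ hg hξ
  set M := MorseGeometry.puncturedManifold n f with hMdef
  set r := ConeBefore (morseCone h f ζ) with hr
  have hchr : IsChronology r f := isChronology_morseCone hV hf hζ
  have hswap := hchr.swap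
  have hfc : Continuous f := hchr.continuous
  have hMo : IsOpen M := isOpen_puncturedManifold hf.contMDiff
  have hmem : ∀ {x y}, r x y → x ∈ M ∧ y ∈ M := fun hxy => hxy.mem_puncturedManifold hζ
  have h₁ : M ∩ f ⁻¹' Set.Ico 0 b = M ∩ {y | f y < b} := by
    ext y
    simp [(hf.mem_Icc y).1]
  have h₂ : M ∩ f ⁻¹' Set.Ioc a 1 = M ∩ {y | a < f y} := by
    ext y
    simp [(hf.mem_Icc y).2]
  rw [h₁, h₂]
  have hM₁o : IsOpen (M ∩ {y | f y < b}) := hMo.inter (isOpen_lt hfc continuous_const)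
  have hM₂o : IsOpen (M ∩ {y | a < f y}) := hMo.inter (isOpen_lt continuous_const hfc)
  refine ⟨?_, ?_⟩
  · ext y
    have := lt_or_ge (f y) b
    have h3 : b ≤ f y → a < f y := hab.trans_le
    simp only [Set.mem_union, Set.mem_inter_iff, Set.mem_ofPred_eq]
    tauto
  have cc := causallyContinuous_iff (g := MorseGeometry.morseMetric h f ζ)
    (T := MorseGeometry.gradient h f) hMo (r := r)
    (fun x y => (chronBefore_iff hf.contMDiff hζ fun p hp _ _ => hp).trans
      ⟨fun H => H.2.2, fun H => ⟨(hmem H).1, (hmem H).2, H⟩⟩)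
    hchr.trans hmem hchr.isOpen_past hchr.isOpen_future
  have cc₁ := causallyContinuous_iff (g := MorseGeometry.morseMetric h f ζ)
    (T := MorseGeometry.gradient h f) hM₁o (r := fun x y => r x y ∧ f y < b)
    (fun x y => by
      constructor
      · intro H
        obtain ⟨γ, h0, h1, hγ⟩ := H
        have hy := (hγ.mapsTo (by simp : (1 : ℝ) ∈ Set.Icc 0 1)).2
        rw [h1] at hy
        exact ⟨((chronBefore_iff (x := x) (y := y) (U := M ∩ {y | f y < b}) hf.contMDiff hζ
          fun p hp _ hpy => ⟨hp, hpy.trans_lt hy⟩).1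
          ⟨γ, h0, h1, hγ⟩).2.2, hy⟩
      · rintro ⟨hxy, hy⟩
        exact (chronBefore_iff (x := x) (y := y) (U := M ∩ {y | f y < b}) hf.contMDiff hζ
          fun p hp _ hpy => ⟨hp, hpy.trans_lt hy⟩).2
          ⟨⟨(hmem hxy).1, (hchr.lt hxy).trans hy⟩, ⟨(hmem hxy).2, hy⟩, hxy⟩)
    (fun H₁ H₂ => ⟨hchr.trans H₁.1 H₂.1, H₂.2⟩)
    (fun H => ⟨⟨(hmem H.1).1, (hchr.lt H.1).trans H.2⟩, ⟨(hmem H.1).2, H.2⟩⟩)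
    (fun x => (hchr.isOpen_past x).inter isOpen_const)
    (fun x => (hchr.isOpen_future x).inter (isOpen_lt hfc continuous_const))
  have cc₂ := causallyContinuous_iff (g := MorseGeometry.morseMetric h f ζ)
    (T := MorseGeometry.gradient h f) hM₂o (r := fun x y => r x y ∧ a < f x)
    (fun x y => by
      constructor
      · intro H
        obtain ⟨γ, h0, h1, hγ⟩ := H
        have hx := (hγ.mapsTo (by simp : (0 : ℝ) ∈ Set.Icc 0 1)).2
        rw [h0] at hx
        exact ⟨((chronBefore_iff (x := x) (y := y) (U := M ∩ {y | a < f y}) hf.contMDiff hζ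
          fun p hp hpx _ => ⟨hp, hx.trans_le hpx⟩).1
          ⟨γ, h0, h1, hγ⟩).2.2, hx⟩
      · rintro ⟨hxy, hx⟩
        exact (chronBefore_iff (x := x) (y := y) (U := M ∩ {y | a < f y}) hf.contMDiff hζ
          fun p hp hpx _ => ⟨hp, hx.trans_le hpx⟩).2
          ⟨⟨(hmem hxy).1, hx⟩, ⟨(hmem hxy).2, hx.trans (hchr.lt hxy)⟩, hxy⟩)
    (fun H₁ H₂ => ⟨hchr.trans H₁.1 H₂.1, H₁.2⟩)
    (fun H => ⟨⟨(hmem H.1).1, H.2⟩, ⟨(hmem H.1).2, H.2.trans (hchr.lt H.1)⟩⟩)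
    (fun x => (hchr.isOpen_past x).inter (isOpen_lt continuous_const hfc))
    (fun x => (hchr.isOpen_future x).inter isOpen_const)
  rw [cc, cc₁, cc₂]
  -- Time reversal by `-f` exchanges sublevel and superlevel sets; these identities let the past
  -- lemmas give the future statements.
  have s₁ : M ∩ {y | -b < (-f) y} = M ∩ {y | f y < b} := by
    ext y
    simp
  have s₂ : M ∩ {y | (-f) y < -a} = M ∩ {y | a < f y} := by
    ext y
    simp
  have r₁ : (fun x y => Function.swap r x y ∧ -b < (-f) x) =
      Function.swap fun x y => r x y ∧ f y < b := by
    funext x y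
    simp [Function.swap]
  have r₂ : (fun x y => Function.swap r x y ∧ (-f) y < -a) =
      Function.swap fun x y => r x y ∧ a < f x := by
    funext x y
    simp [Function.swap]
  constructor
  · intro hcc
    refine ⟨fun x hx hxb => ⟨(hcc x hx.1 hxb).1.sublevel hchr hx.2, ?_⟩,
      fun x hx hxb => ⟨(hcc x hx.1 hxb).1.superlevel hx.2, ?_⟩⟩
    · rw [← r₁, ← s₁]
      exact (hcc x hx.1 hxb).2.superlevel (neg_lt_neg hx.2)
    · rw [← r₂, ← s₂]
      exact (hcc x hx.1 hxb).2.sublevel hswap (neg_lt_neg hx.2)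
  · rintro ⟨hcc₁, hcc₂⟩ x hx hxb
    obtain ⟨c, hac, hcb, hc⟩ := exists_regular_level hV hf hab
    obtain ⟨hcl₁, hcl₂⟩ := mem_closure_morseCone (h := h) hV hf hζ hx hxb
    constructor
    · rcases lt_or_ge (f x) b with hxb' | hxb'
      · exact (hcc₁ x ⟨hx, hxb'⟩ hxb).1.of_sublevel hchr hxb' hcl₁
      · exact (hcc₂ x ⟨hx, hab.trans_le hxb'⟩ hxb).1.of_superlevel hchr hxb' hab hcl₁ hac hcb
          (fun H => (hmem H).1) fun y hy => (hcc₁ y ⟨(hc y hy).1, hy.trans_lt hcb⟩ (hc y hy).2).1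
    · rcases lt_or_ge a (f x) with hxa | hxa
      · have := (hcc₂ x ⟨hx, hxa⟩ hxb).2
        rw [← r₂, ← s₂] at this
        exact this.of_sublevel hswap (neg_lt_neg hxa) hcl₂
      · have := (hcc₁ x ⟨hx, hxa.trans_lt hab⟩ hxb).2
        rw [← r₁, ← s₁] at this
        -- For the reversed chronology the interval is (-b, -a), the level is -c, and M₂ plays the
        -- part of the sublevel set.
        refine this.of_superlevel hswap (neg_le_neg hxa) (neg_lt_neg hab) hcl₂ (neg_lt_neg hcb)
          (neg_lt_neg hac) (fun H => (hmem H).2) fun y hy => ?_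
        have hy' : f y = c := neg_injective hy
        have := (hcc₂ y ⟨(hc y hy').1, hac.trans_eq hy'.symm⟩ (hc y hy').2).2
        rwa [← r₂, ← s₂] at this
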